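/- Let $q$ be a prime power, let $\mathbb{F}_q\subseteq\mathbb{F}_{q^2}$ be finite fields with $q$ and $q^2$ elements, and let $R=\mathbb{F}_q[[T]]+T\,\mathbb{F}_{q^2}[[T]]\subseteq\mathbb{F}_{q^2}[[T]]$. For $n\ge 0$, the free module $R^n$ has only finitely many $R$-submodules of any given finite index. Define the finitized Coh zeta function of $R$ by $$\hat\zeta_{R,n}(s):=\zeta^R_{R^n}(s+n),\qquad \zeta^R_{M}(s):=\sum_{L\subseteq_R M}(M:L)^{-s},$$ where $L$ runs over the finite-index $R$-submodules of $M$, and put $t=q^{-s}$. Write $(a;x)_k:=\prod_{h=0}^{k-1}(1-ax^h)$ and, for integers $n\ge 0$ and $i\ge 0$, $\binom{n}{i}_x:=\frac{(x;x)_n}{(x;x)_i\,(x;x)_{n-i}}$ if $i\le n$ and $\binom{n}{i}_x:=0$ if $i>n$. Then for every $n\ge 0$, as an identity of formal Dirichlet series in $s$ (in which every $(t^2q^{-2};q^{-2})_i$ is invertible), $$\hat\zeta_{R,n}(s)=\sum_{i\ge j\ge 0}(-1)^j\,q^{-(i^2+ij+j)}\binom{n}{i}_{q^{-1}}\frac{(q^{2i};q^{-2})_j}{(q^{-1};q^{-1})_j\,(t^2q^{-2};q^{-2})_i}\,t^{i+j}.$$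 The sum is finite: only the terms with $0\le j\le i\le n$ are nonzero. -/

import Mathlib

namespace InertCoh

open PowerSeries

/-- The order `k[[T]] + T ^ m l[[T]]` in `l[[T]]`, for a field extension `l / k`. -/
def inertOrder (k l : Type*) [Field k] [Field l] [Algebra k l] (m : ℕ) : Subring l⟦X⟧ where
  carrier := {f | ∃ (a : k⟦X⟧) (b : l⟦X⟧), f = PowerSeries.map (algebraMap k l) a + X ^ m * b}
  zero_mem' := ⟨0, 0, by simp⟩
  one_mem' := ⟨1, 0, by simp⟩
  add_mem' := by
    rintro _ _ ⟨a, b, rfl⟩ ⟨a', b', rfl⟩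
    exact ⟨a + a', b + b', by rw [map_add]; ring⟩
  neg_mem' := by
    rintro _ ⟨a, b, rfl⟩
    exact ⟨-a, -b, by rw [map_neg]; ring⟩
  mul_mem' := by
    rintro _ _ ⟨a, b, rfl⟩ ⟨a', b', rfl⟩
    exact ⟨a * a', PowerSeries.map (algebraMap k l) a * b' +
      PowerSeries.map (algebraMap k l) a' * b + X ^ m * b * b', by rw [map_mul]; ring⟩

/-- The submodules of `M` of index `N` (for `N ≠ 0`, these have finite quotient). -/
def submodulesOfIndex (R M : Type*) [CommRing R] [AddCommGroup M] [Module R M] (N : ℕ) :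
    Set (Submodule R M) :=
  {L | Nat.card (M ⧸ L) = N}

/-- The Quot zeta function `∑_L (M : L)^{-s}`, over the finite-index submodules `L` of `M`, as a
formal Dirichlet series: the `N`-th coefficient is the number of submodules of index `N`.
The ring of formal Dirichlet series over `ℚ` is `ArithmeticFunction ℚ`, with
Dirichlet convolution as its product. -/
noncomputable def quotZeta (R M : Type*) [CommRing R] [AddCommGroup M] [Module R M] :
    ArithmeticFunction ℚ :=
  ⟨fun N => if N = 0 then 0 else ((submodulesOfIndex R M N).ncard : ℚ), by simp⟩

/-- The substitution `s ↦ s + n` in a formal Dirichlet series: `∑ a_N N^{-s}` becomes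
`∑ (a_N N^{-n}) N^{-s}`. -/
noncomputable def shift (f : ArithmeticFunction ℚ) (n : ℕ) : ArithmeticFunction ℚ :=
  ⟨fun N => f N * ((N : ℚ) ^ n)⁻¹, by simp⟩

/-- The finitized Coh zeta function `ζ_{R^n}^R(s + n)`. -/
noncomputable def finitizedCohZeta (R : Type*) [CommRing R] (n : ℕ) : ArithmeticFunction ℚ :=
  shift (quotZeta R (Fin n → R)) n

/-- The formal Dirichlet series `q^{-s}`, for `q ≥ 1`. -/
def dirichletMonomial (q : ℕ) : ArithmeticFunction ℚ :=
  ⟨fun N => if N = 0 then 0 else if N = q then 1 else 0, by simp⟩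

/-- The `q`-Pochhammer symbol `(a; q)_n`. -/
def qPochhammer {A : Type*} [CommRing A] (a q : A) (n : ℕ) : A :=
  ∏ k ∈ Finset.range n, (1 - a * q ^ k)

/-- The `q`-binomial coefficient, which is `0` for `k > n`. -/
def qBinomial (n k : ℕ) (q : ℚ) : ℚ :=
  if k ≤ n then qPochhammer q q n / (qPochhammer q q k * qPochhammer q q (n - k)) else 0

end InertCoh

namespace InertCoh

open PowerSeries

/-! ### Formal Dirichlet series -/

/-! Write `S = l⟦X⟧` and `R = inertOrder k l 1`. The maximal ideal of `R` is `T S`, which is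
isomorphic to `S` as an `R`-module, so it pays to count `R`-submodules of all the mixed modules `R^n
× S^d` at once.

Splitting off one factor `R`: a submodule of `R × P` either contains some `(1, p)`, and is then
determined by its trace `L` on `P` and the class of `p` in `P ⧸ L`, or has all its first coordinates
in `T S`, and is then a submodule of `S × P`, up to a factor `q` in the index. Hence
(`HasZeta.prod`) `ζ_{n+1,d}(s) = ζ_{n,d}(s-1) + q^{-s} ζ_{n,d+1}(s)`. By the `q`-Pascal rule this
solves to `ζ_{n,d}(s+n) = ∑_i binom(n,i) q^{-i^2} t^i ζ_{0,d+i}(s+i)`, with the binomial taken at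
`q^{-1}` (`exists_hasZeta_prod`).

It remains to count `R`-submodules `L` of `S^d`. Group them by `M = S L`. Since `T S ⊆ R`, such an
`L` contains `T M`, so it amounts to a `k`-subspace of `M / T M ≅ l^d` that spans over `l`.
Therefore `ζ_{0,d}` is the zeta function of `S^d` over `S` times a polynomial in `t` that does not
depend on `M` (`hasZeta_order_lattices`). The first factor follows from the same splitting over `S`,
where `T S ≅ S` makes the recursion close up (`exists_hasZeta_powerSeries`). The coefficients of the
polynomial count, by trace duality, the `k`-subspaces of `l^d` without nonzero `l`-subspaces, which
are the `k`-spans of `l`-independent tuples (`card_noLine`, `hasZeta_spanning`). -/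

/-- The substitution `s ↦ s - z` in a formal Dirichlet series. -/
noncomputable def twist (z : ℤ) : ArithmeticFunction ℚ →ₐ[ℚ] ArithmeticFunction ℚ where
  toFun f := ⟨fun N => f N * (N : ℚ) ^ z, by simp⟩
  map_one' := by
    ext N
    by_cases h : N = 1 <;> simp [ArithmeticFunction.one_apply, h]
  map_mul' f g := by
    ext N
    simp only [ArithmeticFunction.coe_mk, ArithmeticFunction.mul_apply, Finset.sum_mul]
    refine Finset.sum_congr rfl fun p hp => ?_
    rw [← (Nat.mem_divisorsAntidiagonal.1 hp).1, Nat.cast_mul, mul_zpow, mul_mul_mul_comm]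
    rfl
  map_zero' := by ext; simp
  map_add' f g := by
    ext N
    exact add_mul (f N) (g N) _
  commutes' c := by
    rw [Algebra.algebraMap_eq_smul_one]
    ext N
    by_cases h : N = 1 <;> simp [ArithmeticFunction.one_apply, h]

theorem twist_apply (z : ℤ) (f : ArithmeticFunction ℚ) (N : ℕ) :
    twist z f N = f N * (N : ℚ) ^ z := rfl

theorem twist_twist (y z : ℤ) (f : ArithmeticFunction ℚ) :
    twist y (twist z f) = twist (z + y) f := by
  ext N
  rcases eq_or_ne N 0 with rfl | h
  · simp
  · rw [twist_apply, twist_apply, twist_apply, zpow_add₀ (by exact_mod_cast h), mul_assoc]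

theorem twist_zero (f : ArithmeticFunction ℚ) : twist 0 f = f := by
  ext N; simp [twist_apply]

theorem shift_eq_twist (f : ArithmeticFunction ℚ) (n : ℕ) : shift f n = twist (-n) f := by
  ext N
  rw [twist_apply, zpow_neg, zpow_natCast]; rfl

theorem dirichletMonomial_mul_apply {c : ℕ} (hc : c ≠ 0) (f : ArithmeticFunction ℚ) (N : ℕ) :
    (dirichletMonomial c * f) N = if c ∣ N then f (N / c) else 0 := by
  rcases eq_or_ne N 0 with rfl | hN
  · simp
  have hm : ∀ x, dirichletMonomial c x = if x = c then 1 else 0 := fun x => by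
    by_cases h : x = 0
    · subst h; simp [hc.symm]
    · simp [dirichletMonomial, h]
  rw [ArithmeticFunction.mul_apply]
  simp only [hm, ite_mul, one_mul, zero_mul]
  split_ifs with h
  · obtain ⟨d, rfl⟩ := h
    rw [Finset.sum_eq_single (c, d)]
    · simp [Nat.mul_div_cancel_left d (Nat.pos_of_ne_zero hc)]
    · rintro ⟨a, b⟩ hab hne
      rw [if_neg]
      intro hac
      rw [Nat.mem_divisorsAntidiagonal] at hab
      change a = c at hac
      subst hac
      exact hne (Prod.ext rfl (Nat.eq_of_mul_eq_mul_left (Nat.pos_of_ne_zero hc) hab.1))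
    · intro h
      exact absurd (Nat.mem_divisorsAntidiagonal.2 ⟨rfl, hN⟩) h
  · refine Finset.sum_eq_zero fun p hp => if_neg ?_
    rintro rfl
    exact h ⟨_, (Nat.mem_divisorsAntidiagonal.1 hp).1.symm⟩

theorem dirichletMonomial_apply {c : ℕ} (hc : c ≠ 0) (N : ℕ) :
    dirichletMonomial c N = if N = c then 1 else 0 := by
  by_cases h : N = 0
  · subst h; simp [hc.symm]
  · simp [dirichletMonomial, h]

theorem dirichletMonomial_one : dirichletMonomial 1 = 1 := by
  ext N
  rw [dirichletMonomial_apply one_ne_zero, ArithmeticFunction.one_apply]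

theorem dirichletMonomial_mul {a b : ℕ} (ha : a ≠ 0) (hb : b ≠ 0) :
    dirichletMonomial a * dirichletMonomial b = dirichletMonomial (a * b) := by
  ext N
  rw [dirichletMonomial_mul_apply ha, dirichletMonomial_apply hb,
    dirichletMonomial_apply (mul_ne_zero ha hb)]
  by_cases h : a ∣ N
  · obtain ⟨d, rfl⟩ := h
    simp [Nat.mul_div_cancel_left d (Nat.pos_of_ne_zero ha), ha]
  · rw [if_neg h, if_neg]
    rintro rfl
    exact h ⟨b, rfl⟩

theorem dirichletMonomial_pow {q : ℕ} (hq : q ≠ 0) (i : ℕ) :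
    dirichletMonomial q ^ i = dirichletMonomial (q ^ i) := by
  induction i with
  | zero => simp [dirichletMonomial_one]
  | succ i ih => rw [pow_succ, ih, dirichletMonomial_mul (pow_ne_zero _ hq) hq, pow_succ]

theorem twist_dirichletMonomial (z : ℤ) (q : ℕ) :
    twist z (dirichletMonomial q) = (q : ℚ) ^ z • dirichletMonomial q := by
  ext N
  rw [twist_apply, ArithmeticFunction.smul_map]
  by_cases h : N = q <;> by_cases h0 : N = 0 <;> simp_all [dirichletMonomial]

theorem isUnit_one_sub {u : ArithmeticFunction ℚ} (hu : u 1 = 0) : IsUnit (1 - u) := by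
  rw [ArithmeticFunction.isUnit_iff_isUnit_apply_one, sub_eq_add_neg]
  simp [hu]

/-! ### Counting Dirichlet series of weighted sets -/

/-- The weight `w` takes each nonzero value finitely often, and `∑ x, (w x) ^ (-s)`, the sum being
over the elements of nonzero weight, is the formal Dirichlet series `f`. -/
structure HasZeta {X : Type*} (w : X → ℕ) (f : ArithmeticFunction ℚ) : Prop where
  -- The weights will be values of `Nat.card` on quotients, which is 0 on infinite types. Weight 0
  -- thus marks infinite index and is excluded throughout.
  finite : ∀ N ≠ 0, Finite {x // w x = N}
  card : ∀ N ≠ 0, (Nat.card {x // w x = N} : ℚ) = f N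

namespace HasZeta

variable {X Y : Type*} {w : X → ℕ} {w' : Y → ℕ} {f g : ArithmeticFunction ℚ}

theorem exists_of_finite (h : ∀ N ≠ 0, Finite {x // w x = N}) :
    ∃ F : ArithmeticFunction ℚ, HasZeta w F :=
  ⟨⟨fun N => if N = 0 then 0 else (Nat.card {x // w x = N} : ℚ), by simp⟩, h,
    fun N hN => by simp [hN]⟩

theorem unique (hf : HasZeta w f) (hg : HasZeta w g) : f = g := by
  ext N
  rcases eq_or_ne N 0 with rfl | h
  · simp
  · rw [← hf.card N h, hg.card N h]

theorem congr_equiv (h : HasZeta w' f) (e : X ≃ Y) (he : ∀ x, w' (e x) = w x) : HasZeta w f := by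
  have e' : ∀ N, {x // w x = N} ≃ {y // w' y = N} := fun N =>
    e.subtypeEquiv fun x => by rw [he]
  refine ⟨fun N hN => ?_, fun N hN => ?_⟩
  · have := h.finite N hN
    exact Finite.of_equiv _ (e' N).symm
  · rw [Nat.card_congr (e' N), h.card N hN]

theorem add (p : X → Prop) (hf : HasZeta (fun x : {x // p x} => w x) f)
    (hg : HasZeta (fun x : {x // ¬ p x} => w x) g) : HasZeta w (f + g) := by
  classical
  have e : ∀ N, {x // w x = N} ≃ {x : {x // p x} // w x = N} ⊕ {x : {x // ¬ p x} // w x = N} :=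
    fun N => (Equiv.sumCompl fun x : {x // w x = N} => p x).symm.trans
      (Equiv.sumCongr (Equiv.subtypeSubtypeEquivSubtypeInter _ _ |>.trans <|
        (Equiv.subtypeEquivRight fun _ => and_comm).trans
        (Equiv.subtypeSubtypeEquivSubtypeInter p _).symm)
        (Equiv.subtypeSubtypeEquivSubtypeInter _ (fun x => ¬ p x) |>.trans <|
        (Equiv.subtypeEquivRight fun _ => and_comm).trans
        (Equiv.subtypeSubtypeEquivSubtypeInter _ _).symm))
  refine ⟨fun N hN => ?_, fun N hN => ?_⟩
  · have := hf.finite N hN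
    have := hg.finite N hN
    exact Finite.of_equiv _ (e N).symm
  · have := hf.finite N hN
    have := hg.finite N hN
    rw [Nat.card_congr (e N), Nat.card_sum, Nat.cast_add, hf.card N hN, hg.card N hN,
      ArithmeticFunction.add_apply]

theorem const_mul (h : HasZeta w f) {c : ℕ} (hc : c ≠ 0) :
    HasZeta (fun x => c * w x) (dirichletMonomial c * f) := by
  have e : ∀ N, {x // c * w x = c * N} ≃ {x // w x = N} := fun N =>
    Equiv.subtypeEquivRight fun x => by simp [hc]
  have e0 : ∀ N, ¬ c ∣ N → IsEmpty {x // c * w x = N} := fun N hN =>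
    ⟨fun x => hN ⟨_, x.2.symm⟩⟩
  refine ⟨fun N hN => ?_, fun N hN => ?_⟩
  · by_cases hd : c ∣ N
    · obtain ⟨d, rfl⟩ := hd
      have := h.finite d (right_ne_zero_of_mul hN)
      exact Finite.of_equiv _ (e d).symm
    · have := e0 N hd
      infer_instance
  · rw [dirichletMonomial_mul_apply hc]
    split_ifs with hd
    · obtain ⟨d, rfl⟩ := hd
      rw [Nat.card_congr (e d), h.card d (right_ne_zero_of_mul hN),
        Nat.mul_div_cancel_left d (Nat.pos_of_ne_zero hc)]
    · have := e0 N hd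
      simp

/-- Each point of weight `N` has `N` points above it, so the `N`-th coefficient is multiplied by
`N`, which is the shift `s ↦ s - 1`. -/
theorem of_fibers_card (h : HasZeta w' f) (π : X → Y) (hw : ∀ x, w x = w' (π x))
    (hπ : ∀ y, w' y ≠ 0 → Nat.card {x // π x = y} = w' y) : HasZeta w (twist 1 f) := by
  have e : ∀ N, {x // w x = N} ≃ Σ y : {y // w' y = N}, {x // π x = y} := fun N =>
    { toFun x := ⟨⟨π x, by rw [← hw, x.2]⟩, x, rfl⟩
      invFun z := ⟨z.2, by rw [hw, z.2.2, z.1.2]⟩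
      left_inv _ := rfl
      right_inv := by
        rintro ⟨⟨y, hy⟩, x, hx⟩
        change π x = y at hx
        subst hx
        rfl }
  have hfin : ∀ N ≠ 0, ∀ y : {y // w' y = N}, Finite {x // π x = y} := by
    rintro _ hN ⟨y, rfl⟩
    exact Nat.finite_of_card_ne_zero (by rw [hπ y hN]; exact hN)
  refine ⟨fun N hN => ?_, fun N hN => ?_⟩
  · have := h.finite N hN
    have := hfin N hN
    exact Finite.of_equiv _ (e N).symm
  · have := h.finite N hN
    have := hfin N hN
    have := Fintype.ofFinite {y // w' y = N}
    rw [Nat.card_congr (e N), Nat.card_sigma, Finset.sum_congr rfl (g := fun _ => N)]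
    · rw [Finset.sum_const, Finset.card_univ, ← Nat.card_eq_fintype_card, twist_apply,
        ← h.card N hN]
      simp
    · rintro ⟨y, rfl⟩ -
      exact hπ y hN

theorem mul_of_fibers (h : HasZeta w' f) (π : X → Y) (v : X → ℕ)
    (hw : ∀ x, w x = w' (π x) * v x)
    (hπ : ∀ y, w' y ≠ 0 → HasZeta (fun x : {x // π x = y} => v x) g) : HasZeta w (f * g) := by
  have e : ∀ N ≠ 0, {x // w x = N} ≃ Σ p : N.divisorsAntidiagonal, Σ y : {y // w' y = p.1.1},
      {x : {x // π x = y} // v x = p.1.2} := fun N hN =>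
    { toFun x := ⟨⟨(w' (π x), v x), Nat.mem_divisorsAntidiagonal.2 ⟨by rw [← hw, x.2], hN⟩⟩,
        ⟨π x, rfl⟩, ⟨x, rfl⟩, rfl⟩
      invFun z := ⟨z.2.2.1, by
        rw [hw, z.2.2.1.2, z.2.1.2, z.2.2.2, (Nat.mem_divisorsAntidiagonal.1 z.1.2).1]⟩
      left_inv _ := rfl
      right_inv := by
        rintro ⟨⟨⟨a, b⟩, hp⟩, ⟨y, hy⟩, ⟨x, hx⟩, hv⟩
        change w' y = a at hy
        change π x = y at hx
        change v x = b at hv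
        subst hx hy hv
        rfl }
  have h0 : ∀ {N : ℕ} (p : N.divisorsAntidiagonal), p.1.1 ≠ 0 ∧ p.1.2 ≠ 0 := fun {N} p => by
    have := Nat.mem_divisorsAntidiagonal.1 p.2
    rw [← mul_ne_zero_iff, this.1]
    exact this.2
  have f1 : ∀ {N : ℕ} (p : N.divisorsAntidiagonal), Finite {y // w' y = p.1.1} :=
    fun p => h.finite _ (h0 p).1
  have f2 : ∀ {N : ℕ} (p : N.divisorsAntidiagonal) (y : {y // w' y = p.1.1}),
      Finite {x : {x // π x = y} // v x = p.1.2} :=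
    fun p y => (hπ y (by rw [y.2]; exact (h0 p).1)).finite _ (h0 p).2
  refine ⟨fun N hN => Finite.of_equiv _ (e N hN).symm, fun N hN => ?_⟩
  rw [Nat.card_congr (e N hN), Nat.card_sigma, ArithmeticFunction.mul_apply,
    ← Finset.sum_coe_sort N.divisorsAntidiagonal, Nat.cast_sum]
  refine Finset.sum_congr rfl fun p _ => ?_
  have := Fintype.ofFinite {y // w' y = p.1.1}
  rw [Nat.card_sigma, Nat.cast_sum, Finset.sum_congr rfl (g := fun _ => g p.1.2)]
  · rw [Finset.sum_const, Finset.card_univ, ← Nat.card_eq_fintype_card, nsmul_eq_mul,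
      h.card _ (h0 p).1]
  · intro y _
    exact (hπ y (by rw [y.2]; exact (h0 p).1)).card _ (h0 p).2

/-- The unknown series `F` satisfies `F = f + c^{-s} F`. Finiteness has to come before `F` exists:
outside `p` the weight is `c > 1` times the weight of another point, so strong induction on the
weight applies. -/
theorem of_self_similar (p : X → Prop) (hf : HasZeta (fun x : {x // p x} => w x) f)
    (e : {x // ¬ p x} ≃ X) {c : ℕ} (hc : 1 < c) (he : ∀ x : {x // ¬ p x}, w x = c * w (e x)) :
    HasZeta w (Ring.inverse (1 - dirichletMonomial c) * f) := by
  have hfin : ∀ N ≠ 0, Finite {x // w x = N} := by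
    intro N
    induction N using Nat.strong_induction_on with
    | _ N ih =>
      intro hN
      have h1 : ({x | w x = N} ∩ {x | p x}).Finite := by
        have := hf.finite N hN
        refine (Set.finite_range fun x : {x : {x // p x} // w x = N} => (x.1 : X)).subset ?_
        rintro x ⟨hx, hp⟩
        exact ⟨⟨⟨x, hp⟩, hx⟩, rfl⟩
      have h2 : ({x | w x = N} ∩ {x | ¬ p x}).Finite := by
        by_cases hd : c ∣ N
        · obtain ⟨d, rfl⟩ := hd
          have hd0 := right_ne_zero_of_mul hN
          have := ih d (lt_mul_left (Nat.pos_of_ne_zero hd0) hc) hd0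
          refine (Set.finite_range fun x : {x : X // w x = d} => (e.symm x : X)).subset ?_
          rintro x ⟨hx, hp⟩
          refine ⟨⟨e ⟨x, hp⟩, ?_⟩, by simp⟩
          exact Nat.eq_of_mul_eq_mul_left (by omega) ((he ⟨x, hp⟩).symm.trans hx)
        · refine Set.Finite.subset Set.finite_empty ?_
          rintro x ⟨hx, hp⟩
          exact hd ⟨_, hx.symm.trans (he ⟨x, hp⟩)⟩
      refine Set.Finite.subset (h1.union h2) fun x hx => ?_
      by_cases hp : p x
      · exact Or.inl ⟨hx, hp⟩
      · exact Or.inr ⟨hx, hp⟩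
  obtain ⟨F, hF⟩ := exists_of_finite hfin
  have hg := (hF.const_mul (c := c) (by omega)).congr_equiv (w := fun x : {x // ¬ p x} => w x) e
    fun x => (he x).symm
  have heq := hF.unique (add p hf hg)
  have hu : IsUnit (1 - dirichletMonomial c) := isUnit_one_sub (by
    rw [dirichletMonomial_apply (by omega), if_neg (by omega)])
  refine (?_ : _ = Ring.inverse (1 - dirichletMonomial c) * f) ▸ hF
  refine hu.mul_left_cancel ?_
  rw [Ring.mul_inverse_cancel_left _ _ hu, sub_mul, one_mul]
  exact sub_eq_of_eq_add heq

end HasZeta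

/-! ### Counting submodules of a product -/

section Product

variable {O A P : Type*} [CommRing O] [AddCommGroup A] [Module O A] [AddCommGroup P] [Module O P]

theorem HasZeta.of_linearEquiv {M M' : Type*} [AddCommGroup M] [Module O M] [AddCommGroup M']
    [Module O M'] {f : ArithmeticFunction ℚ}
    (h : HasZeta (fun L : Submodule O M' => Nat.card (M' ⧸ L)) f) (e : M ≃ₗ[O] M') :
    HasZeta (fun L : Submodule O M => Nat.card (M ⧸ L)) f :=
  h.congr_equiv (Submodule.orderIsoMapComap e).toEquiv fun L =>
    Nat.card_congr (Submodule.Quotient.equiv L _ e rfl).toEquiv.symm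

theorem card_quotient_eq_index {M : Type*} [AddCommGroup M] [Module O M] (L : Submodule O M) :
    Nat.card (M ⧸ L) = L.toAddSubgroup.index := rfl

theorem card_quotient_comap_inr (L : Submodule O (O × P)) {p : P} (hp : (1, p) ∈ L) :
    Nat.card (P ⧸ L.comap (LinearMap.inr O O P)) = Nat.card ((O × P) ⧸ L) := by
  have hs : Function.Surjective (L.mkQ ∘ₗ LinearMap.inr O O P) := by
    intro x
    obtain ⟨⟨r, y⟩, rfl⟩ := L.mkQ_surjective x
    -- Modulo `L`, subtracting `r • (1, p)` clears the first coordinate.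
    refine ⟨y - r • p, ?_⟩
    rw [LinearMap.comp_apply, Submodule.mkQ_apply, Submodule.mkQ_apply, Submodule.Quotient.eq]
    convert L.smul_mem (-r) hp using 1
    ext <;> simp
  refine Nat.card_congr ((Submodule.quotEquivOfEq _ _ ?_).trans
    (LinearMap.quotKerEquivOfSurjective _ hs)).toEquiv
  rw [LinearMap.ker_comp, Submodule.ker_mkQ]

/-- The graph of the linear map `O → P ⧸ L` taking `1` to `c`, as a submodule of `O × P`. -/
def quotientGraph (L : Submodule O P) (c : P ⧸ L) : Submodule O (O × P) :=
  LinearMap.ker (L.mkQ ∘ₗ LinearMap.snd O O P -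
    LinearMap.toSpanSingleton O _ c ∘ₗ LinearMap.fst O O P)

theorem mem_quotientGraph {L : Submodule O P} {c : P ⧸ L} {r : O} {p : P} :
    (r, p) ∈ quotientGraph L c ↔ L.mkQ p = r • c := by
  simp [quotientGraph, sub_eq_zero]

/-- A submodule `K` containing some `(1, p)` is the same as a pair of `L = K ∩ P` and the class of
`p` in `P ⧸ L`. The index of `K` equals that of `L`, and there are `(P : L)` classes. -/
theorem HasZeta.graphs {f : ArithmeticFunction ℚ}
    (h : HasZeta (fun L : Submodule O P => Nat.card (P ⧸ L)) f) :
    HasZeta (fun L : {L : Submodule O (O × P) // ∃ p, (1, p) ∈ L} => Nat.card ((O × P) ⧸ L.1))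
      (twist 1 f) := by
  refine h.of_fibers_card (fun L => L.1.comap (LinearMap.inr O O P))
    (fun L => (card_quotient_comap_inr L.1 L.2.choose_spec).symm) fun L _ => ?_
  symm
  have h1 : ∀ c : P ⧸ L, ∃ p, (1, p) ∈ quotientGraph L c := fun c => by
    obtain ⟨p, rfl⟩ := L.mkQ_surjective c
    exact ⟨p, mem_quotientGraph.2 (one_smul _ _).symm⟩
  have h2 : ∀ c : P ⧸ L, (quotientGraph L c).comap (LinearMap.inr O O P) = L := fun c => by
    ext p
    rw [Submodule.mem_comap, LinearMap.inr_apply, mem_quotientGraph, zero_smul,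
      Submodule.mkQ_apply, Submodule.Quotient.mk_eq_zero]
  refine Nat.card_eq_of_bijective (fun c => ⟨⟨quotientGraph L c, h1 c⟩, h2 c⟩) ⟨?_, ?_⟩
  · intro c c' hcc
    have hcc' : quotientGraph L c = quotientGraph L c' :=
      congrArg (fun x => x.1.1) hcc
    obtain ⟨p, hp⟩ := h1 c
    have hp' := hcc' ▸ hp
    rw [mem_quotientGraph, one_smul] at hp hp'
    exact hp.symm.trans hp'
  · rintro ⟨⟨K, p, hp⟩, hK⟩
    refine ⟨L.mkQ p, Subtype.ext (Subtype.ext ?_)⟩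
    ext ⟨r, y⟩
    change (r, y) ∈ quotientGraph L _ ↔ (r, y) ∈ K
    change K.comap _ = L at hK
    rw [mem_quotientGraph, ← map_smul, ← sub_eq_zero, ← map_sub, Submodule.mkQ_apply,
      Submodule.Quotient.mk_eq_zero, ← hK, Submodule.mem_comap, LinearMap.inr_apply]
    have : (r, y) = ((0 : O), y - r • p) + r • (1, p) := by ext <;> simp
    rw [this, K.add_mem_iff_left (K.smul_mem r hp)]

/-- The submodules contained in the range of an injective linear map. -/
def submoduleLeRangeEquiv {B C : Type*} [AddCommGroup B] [Module O B] [AddCommGroup C] [Module O C]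
    (i : B →ₗ[O] C) (hi : Function.Injective i) :
    {L : Submodule O C // L ≤ LinearMap.range i} ≃ Submodule O B where
  toFun L := L.1.comap i
  invFun K := ⟨K.map i, LinearMap.map_le_range⟩
  left_inv L := Subtype.ext (Submodule.map_comap_eq_of_le L.2)
  right_inv K := Submodule.comap_map_eq_of_injective hi K

theorem card_quotient_of_le_range {B C : Type*} [AddCommGroup B] [Module O B] [AddCommGroup C]
    [Module O C] (i : B →ₗ[O] C) {L : Submodule O C} (hL : L ≤ LinearMap.range i) :
    Nat.card (C ⧸ L) = Nat.card (C ⧸ LinearMap.range i) * Nat.card (B ⧸ L.comap i) := by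
  have h1 : L.toAddSubgroup.relIndex (LinearMap.range i).toAddSubgroup *
      (LinearMap.range i).toAddSubgroup.index = L.toAddSubgroup.index :=
    AddSubgroup.relIndex_mul_index (Submodule.toAddSubgroup_le _ _ |>.2 hL)
  have h2 : (L.comap i).toAddSubgroup.index =
      L.toAddSubgroup.relIndex (LinearMap.range i).toAddSubgroup := by
    rw [LinearMap.range_toAddSubgroup]
    exact AddSubgroup.index_comap L.toAddSubgroup i.toAddMonoidHom
  rw [card_quotient_eq_index, card_quotient_eq_index, card_quotient_eq_index, ← h1, mul_comm, h2]

variable (i : A →ₗ[O] O)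

theorem card_quotient_range_prodMap_id :
    Nat.card ((O × P) ⧸ LinearMap.range (i.prodMap (LinearMap.id : P →ₗ[O] P))) =
      Nat.card (O ⧸ LinearMap.range i) := by
  have hs : Function.Surjective ((LinearMap.range i).mkQ ∘ₗ LinearMap.fst O O P) :=
    (Submodule.mkQ_surjective _).comp Prod.fst_surjective
  refine Nat.card_congr ((Submodule.quotEquivOfEq _ _ ?_).trans
    (LinearMap.quotKerEquivOfSurjective _ hs)).toEquiv
  rw [LinearMap.ker_comp, Submodule.ker_mkQ]
  ext ⟨r, p⟩
  simp

theorem prodMap_id_injective (hi : Function.Injective i) :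
    Function.Injective (i.prodMap (LinearMap.id : P →ₗ[O] P)) := by
  rintro ⟨a, p⟩ ⟨b, p'⟩ h
  simp only [LinearMap.prodMap_apply, LinearMap.id_apply, Prod.mk.injEq] at h
  exact Prod.ext (hi h.1) h.2

/-- An element whose first coordinate is a unit can be rescaled to have first coordinate 1. -/
theorem not_exists_one_mem_iff (hr : ∀ r : O, r ∈ LinearMap.range i ↔ ¬ IsUnit r)
    (L : Submodule O (O × P)) :
    (¬ ∃ p, (1, p) ∈ L) ↔ L ≤ LinearMap.range (i.prodMap (LinearMap.id : P →ₗ[O] P)) := by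
  constructor
  · rintro h ⟨r, p⟩ hrp
    have hu : ¬ IsUnit r := by
      rintro ⟨u, rfl⟩
      refine h ⟨(↑u⁻¹ : O) • p, ?_⟩
      simpa using L.smul_mem (↑u⁻¹ : O) hrp
    obtain ⟨a, ha⟩ := (hr r).2 hu
    exact ⟨(a, p), by simp [ha]⟩
  · rintro h ⟨p, hp⟩
    obtain ⟨⟨a, p'⟩, h1⟩ := h hp
    exact (hr 1).1 ⟨a, congrArg Prod.fst h1⟩ isUnit_one

/-- Submodules of `O × P` all of whose first coordinates lie in the ideal `i(A)` of non-units. -/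
noncomputable def nongraphEquiv (hi : Function.Injective i)
    (hr : ∀ r : O, r ∈ LinearMap.range i ↔ ¬ IsUnit r) :
    {L : Submodule O (O × P) // ¬ ∃ p, (1, p) ∈ L} ≃ Submodule O (A × P) :=
  (Equiv.subtypeEquivRight (not_exists_one_mem_iff i hr)).trans
    (submoduleLeRangeEquiv _ (prodMap_id_injective i hi))

theorem card_quotient_nongraph (hi : Function.Injective i)
    (hr : ∀ r : O, r ∈ LinearMap.range i ↔ ¬ IsUnit r)
    (L : {L : Submodule O (O × P) // ¬ ∃ p, (1, p) ∈ L}) :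
    Nat.card ((O × P) ⧸ L.1) = Nat.card (O ⧸ LinearMap.range i) *
      Nat.card ((A × P) ⧸ nongraphEquiv i hi hr L) := by
  rw [card_quotient_of_le_range _ ((not_exists_one_mem_iff i hr L.1).1 L.2),
    card_quotient_range_prodMap_id]
  rfl

/-- The two summands count the graph-like submodules and those inside `i(A) × P`, an image of `A ×
P` of index `c`. -/
theorem HasZeta.prod (hi : Function.Injective i)
    (hr : ∀ r : O, r ∈ LinearMap.range i ↔ ¬ IsUnit r)
    {c : ℕ} (hc : Nat.card (O ⧸ LinearMap.range i) = c) (hc0 : c ≠ 0) {f g : ArithmeticFunction ℚ}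
    (hf : HasZeta (fun L : Submodule O P => Nat.card (P ⧸ L)) f)
    (hg : HasZeta (fun L : Submodule O (A × P) => Nat.card ((A × P) ⧸ L)) g) :
    HasZeta (fun L : Submodule O (O × P) => Nat.card ((O × P) ⧸ L))
      (twist 1 f + dirichletMonomial c * g) := by
  refine HasZeta.add _ hf.graphs ((hg.const_mul hc0).congr_equiv (nongraphEquiv i hi hr) ?_)
  intro L
  rw [card_quotient_nongraph i hi hr, hc]

theorem HasZeta.prod_self (j : O →ₗ[O] O) (hj : Function.Injective j)
    (hr : ∀ r : O, r ∈ LinearMap.range j ↔ ¬ IsUnit r)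
    {c : ℕ} (hc : Nat.card (O ⧸ LinearMap.range j) = c) (hc1 : 1 < c) {f : ArithmeticFunction ℚ}
    (hf : HasZeta (fun L : Submodule O P => Nat.card (P ⧸ L)) f) :
    HasZeta (fun L : Submodule O (O × P) => Nat.card ((O × P) ⧸ L))
      (Ring.inverse (1 - dirichletMonomial c) * twist 1 f) := by
  refine HasZeta.of_self_similar _ hf.graphs (nongraphEquiv j hj hr) hc1 fun L => ?_
  rw [card_quotient_nongraph j hj hr, hc]

theorem hasZeta_of_subsingleton [Subsingleton P] :
    HasZeta (fun L : Submodule O P => Nat.card (P ⧸ L)) 1 := by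
  have h1 : ∀ L : Submodule O P, Nat.card (P ⧸ L) = 1 := fun L => by
    rw [Nat.card_eq_one_iff_unique]
    exact ⟨inferInstance, inferInstance⟩
  refine ⟨fun N _ => inferInstance, fun N _ => ?_⟩
  by_cases h : N = 1
  · rw [Nat.card_congr (Equiv.subtypeUnivEquiv fun L => (h1 L).trans h.symm), h]
    simp
  · have : IsEmpty {L : Submodule O P // Nat.card (P ⧸ L) = N} :=
      ⟨fun L => h (L.2.symm.trans (h1 L))⟩
    rw [Nat.card_of_isEmpty, ArithmeticFunction.one_apply, if_neg h, Nat.cast_zero]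

end Product

/-! ### Spanning subspaces over a quadratic subfield -/

section Spanning

variable {k l V : Type*} [Field k] [Field l] [Algebra k l] [AddCommGroup V] [Module k V]
  [Module l V] [IsScalarTower k l V]

theorem exists_quadratic_generator (hl : Module.finrank k l = 2) :
    ∃ α : l, (∀ a : k, algebraMap k l a ≠ α) ∧
      ∀ c : l, ∃ a b : k, c = algebraMap k l a + algebraMap k l b * α := by
  have h1 : ∃ α : l, ∀ a : k, algebraMap k l a ≠ α := by
    by_contra! h
    have h2 : Function.Bijective (Algebra.linearMap k l) :=
      ⟨(algebraMap k l).injective, h⟩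
    have := (LinearEquiv.ofBijective _ h2).finrank_eq
    rw [Module.finrank_self, hl] at this
    omega
  obtain ⟨α, hα⟩ := h1
  refine ⟨α, hα, fun c => ?_⟩
  have hli : LinearIndependent k ![(1 : l), α] := by
    rw [LinearIndependent.pair_iff]
    intro s t hst
    have ht : t = 0 := by
      by_contra ht
      refine hα (-s / t) ?_
      rw [Algebra.smul_def, Algebra.smul_def, mul_one] at hst
      have : algebraMap k l t ≠ 0 := by simpa using ht
      rw [map_div₀, map_neg, div_eq_iff this]
      linear_combination -hst
    subst ht
    simpa using hst
  have hsp := hli.span_eq_top_of_card_eq_finrank (by simp [hl])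
  have hc : c ∈ Submodule.span k (Set.range ![(1 : l), α]) := hsp ▸ Submodule.mem_top
  rw [Matrix.range_cons, Matrix.range_cons, Matrix.range_empty, Set.union_empty,
    Set.singleton_union, Submodule.mem_span_pair] at hc
  obtain ⟨a, b, rfl⟩ := hc
  exact ⟨a, b, by rw [Algebra.smul_def, Algebra.smul_def, mul_one]⟩

variable (l) in
/-- The `k`-subspace `U` of the `l`-space `V` contains no nonzero `l`-subspace. -/
def NoLine (U : Submodule k V) : Prop := ∀ y : V, (∀ a : l, a • y ∈ U) → y = 0

/-- With `l = k + k α`, an `l`-relation reads `x + α y = 0` with `x, y ∈ U`. Then `y` and `α y = -x`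
lie in `U`, so `l y ⊆ U`, which forces `y = 0` and then `x = 0`. -/
theorem linearIndependent_of_noLine (hl : Module.finrank k l = 2) {U : Submodule k V}
    (hU : NoLine l U) {j : ℕ} {s : Fin j → V} (hs : LinearIndependent k s) (hsU : ∀ i, s i ∈ U) :
    LinearIndependent l s := by
  obtain ⟨α, -, hα⟩ := exists_quadratic_generator hl
  choose a b hab using hα
  rw [Fintype.linearIndependent_iff] at hs ⊢
  intro c hc
  have hx : ∑ i, a (c i) • s i ∈ U := U.sum_mem fun i _ => U.smul_mem _ (hsU i)
  have hy : ∑ i, b (c i) • s i ∈ U := U.sum_mem fun i _ => U.smul_mem _ (hsU i)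
  have hxy : ∑ i, a (c i) • s i + α • ∑ i, b (c i) • s i = 0 := by
    rw [← hc, Finset.smul_sum, ← Finset.sum_add_distrib]
    refine Finset.sum_congr rfl fun i _ => ?_
    conv_rhs => rw [hab (c i)]
    rw [add_smul, algebraMap_smul, mul_comm, mul_smul, algebraMap_smul]
  have hy0 : ∑ i, b (c i) • s i = 0 := by
    refine hU _ fun e => ?_
    rw [hab e, add_smul, algebraMap_smul, mul_smul, algebraMap_smul,
      eq_neg_of_add_eq_zero_right hxy]
    exact U.add_mem (U.smul_mem _ hy) (U.smul_mem _ (U.neg_mem hx))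
  have hx0 : ∑ i, a (c i) • s i = 0 := by simpa [hy0] using hxy
  intro i
  rw [hab (c i), hs _ hx0 i, hs _ hy0 i]
  simp

/-- If `y` and `α y` both have coordinates in `k`, comparing them coordinatewise puts `α` in `k`
unless `y = 0`. -/
theorem noLine_span (hl : Module.finrank k l = 2) {j : ℕ} {s : Fin j → V}
    (hs : LinearIndependent l s) : NoLine l (Submodule.span k (Set.range s)) := by
  obtain ⟨α, hα, -⟩ := exists_quadratic_generator hl
  intro y hy
  have h1 := hy 1
  have h2 := hy α
  rw [one_smul, Submodule.mem_span_range_iff_exists_fun] at h1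
  rw [Submodule.mem_span_range_iff_exists_fun] at h2
  obtain ⟨a, rfl⟩ := h1
  obtain ⟨b, hb⟩ := h2
  rw [Fintype.linearIndependent_iff] at hs
  have h3 := hs (fun i => algebraMap k l (b i) - α * algebraMap k l (a i)) (by
    simp only [sub_smul, mul_smul, algebraMap_smul, Finset.sum_sub_distrib, ← Finset.smul_sum]
    rw [hb, sub_self])
  refine Finset.sum_eq_zero fun i _ => ?_
  have ha : a i = 0 := by
    by_contra ha
    refine hα (b i / a i) ?_
    have : algebraMap k l (a i) ≠ 0 := by simpa using ha
    rw [map_div₀, div_eq_iff this]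
    exact sub_eq_zero.1 (h3 i)
  rw [ha, zero_smul]

/-- Double count along `s ↦ span k s`: the fibre over `U` consists of all ordered `k`-bases of `U`,
which are automatically independent over `l`. -/
theorem card_noLine_mul [Finite k] [Finite V] (hl : Module.finrank k l = 2) (j : ℕ) :
    Nat.card {U : Submodule k V // NoLine l U ∧ Module.finrank k U = j} *
      (∏ i : Fin j, (Nat.card k ^ j - Nat.card k ^ i.val)) =
    Nat.card {s : Fin j → V // LinearIndependent l s} := by
  have := Fintype.ofFinite k
  have hli : ∀ s : Fin j → V, LinearIndependent l s → LinearIndependent k s :=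
    fun s hs => hs.restrict_scalars' k
  let π : {s : Fin j → V // LinearIndependent l s} →
      {U : Submodule k V // NoLine l U ∧ Module.finrank k U = j} := fun s =>
    ⟨Submodule.span k (Set.range s.1), noLine_span hl s.2, by
      rw [finrank_span_eq_card (hli s.1 s.2), Fintype.card_fin]⟩
  have hπ : ∀ U, Nat.card {s // π s = U} =
      ∏ i : Fin j, (Nat.card k ^ j - Nat.card k ^ i.val) := by
    intro U
    have h := card_linearIndependent (K := k) (V := U.1) (k := j) (le_of_eq U.2.2.symm)
    rw [U.2.2, ← Nat.card_eq_fintype_card] at h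
    rw [← h]
    have hmem : ∀ s, π s = U → ∀ i, s.1 i ∈ U.1 := fun s hs i => by
      rw [← hs]
      exact Submodule.subset_span ⟨i, rfl⟩
    refine Nat.card_congr
      { toFun s := ⟨fun i => ⟨s.1.1 i, hmem s.1 s.2 i⟩,
          LinearIndependent.of_comp U.1.subtype (hli _ s.1.2)⟩
        invFun s := ⟨⟨fun i => s.1 i, linearIndependent_of_noLine hl U.2.1
            (s.2.map' U.1.subtype U.1.ker_subtype) fun i => (s.1 i).2⟩, Subtype.ext ?_⟩
        left_inv _ := rfl
        right_inv _ := rfl }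
    refine Submodule.eq_of_le_of_finrank_eq ?_ ?_
    · rw [Submodule.span_le]
      rintro _ ⟨i, rfl⟩
      exact (s.1 i).2
    · exact (finrank_span_eq_card (s.2.map' U.1.subtype U.1.ker_subtype)).trans
        ((Fintype.card_fin j).trans U.2.2.symm)
  have := Fintype.ofFinite {U : Submodule k V // NoLine l U ∧ Module.finrank k U = j}
  rw [Nat.card_congr (Equiv.sigmaFiberEquiv π).symm, Nat.card_sigma,
    Finset.sum_congr rfl fun U _ => hπ U, Finset.sum_const, Finset.card_univ,
    Nat.card_eq_fintype_card, smul_eq_mul]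

theorem exists_trace_form [Finite k] [FiniteDimensional k l] [FiniteDimensional l V] :
    ∃ B : LinearMap.BilinForm k V, B.Nondegenerate ∧ B.IsSymm ∧
      ∀ (a : l) (x y : V), B (a • x) y = B x (a • y) := by
  have : Finite l := Module.finite_of_finite k
  let e := (Module.finBasis l V).equivFun
  let B : LinearMap.BilinForm k V := LinearMap.mk₂ k
    (fun x y => Algebra.trace k l (∑ i, e x i * e y i))
    (by intros; simp [add_mul, Finset.sum_add_distrib])
    (fun c x y => by
      rw [← map_smul, Finset.smul_sum, ← algebraMap_smul l c x, map_smul]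
      simp [Algebra.smul_def, mul_assoc])
    (by intros; simp [mul_add, Finset.sum_add_distrib])
    (fun c x y => by
      rw [← map_smul, Finset.smul_sum, ← algebraMap_smul l c y, map_smul]
      simp [Algebra.smul_def, mul_left_comm])
  have hB : ∀ x y, B x y = Algebra.trace k l (∑ i, e x i * e y i) := fun _ _ => rfl
  have hs : B.IsSymm := ⟨fun x y => by simp [hB, mul_comm]⟩
  refine ⟨B, ?_, hs, fun a x y => ?_⟩
  · refine (LinearMap.IsRefl.nondegenerate_iff_separatingLeft hs.isRefl).2 ?_
    intro x hx
    rw [← e.map_eq_zero_iff]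
    ext i
    -- Pairing with `c` times the `i`-th basis vector isolates the `i`-th coordinate and reduces to
    -- the trace form of `l / k`.
    refine (traceForm_nondegenerate k l).1 _ fun c => ?_
    have := hx (e.symm (Pi.single i c))
    rw [hB, e.apply_symm_apply, Finset.sum_eq_single i] at this
    · simpa [Algebra.traceForm_apply] using this
    · intro j _ hj
      simp [hj]
    · simp
  · simp [hB, mul_left_comm, mul_assoc]

/-- Scalars of `l` are self-adjoint for `B`, so the largest `l`-subspace inside the orthogonal of
`W` is the orthogonal of the `l`-span of `W`. -/
theorem noLine_orthogonal_iff [FiniteDimensional k V] {B : LinearMap.BilinForm k V}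
    (hB : B.Nondegenerate) (hs : B.IsSymm)
    (ha : ∀ (a : l) (x y : V), B (a • x) y = B x (a • y)) (W : Submodule k V) :
    NoLine l (B.orthogonal W) ↔ Submodule.span l (W : Set V) = ⊤ := by
  constructor
  · intro h
    set N := Submodule.span l (W : Set V) with hN
    have hbot : B.orthogonal (N.restrictScalars k) = ⊥ := by
      rw [eq_bot_iff]
      intro y hy
      refine h y fun a => ?_
      rw [LinearMap.BilinForm.mem_orthogonal_iff] at hy ⊢
      intro w hw
      have := hy (a • w) (N.smul_mem a (Submodule.subset_span hw))
      rwa [ha] at this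
    have h1 := LinearMap.BilinForm.orthogonal_orthogonal hB hs.isRefl (N.restrictScalars k)
    rw [hbot, LinearMap.BilinForm.orthogonal_bot] at h1
    rwa [eq_comm, Submodule.restrictScalars_eq_top_iff] at h1
  · intro h y hy
    refine hB.2 y fun x => ?_
    have hx : x ∈ Submodule.span l (W : Set V) := h ▸ Submodule.mem_top
    have h2 : ∀ a : l, B (a • x) y = 0 := by
      induction hx using Submodule.span_induction with
      | mem w hw =>
        intro a
        rw [ha]
        exact (LinearMap.BilinForm.mem_orthogonal_iff.1 (hy a)) w hw
      | zero => simp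
      | add u v _ _ hu hv => intro a; rw [smul_add, map_add, LinearMap.add_apply, hu, hv, add_zero]
      | smul c u _ hu => intro a; rw [smul_smul]; exact hu _
    simpa using h2 1

/-- The number of `k`-subspaces of codimension `j` of an `l`-space of dimension `d` that span it
over `l`, where `k` has `q` elements and `l` has `q ^ 2`. -/
def spanningCount (q d j : ℕ) : ℚ :=
  ∏ h ∈ Finset.range j, (((q : ℚ) ^ (2 * d) - (q : ℚ) ^ (2 * h)) / ((q : ℚ) ^ j - (q : ℚ) ^ h))

theorem spanningCount_eq_zero {q d j : ℕ} (h : d < j) : spanningCount q d j = 0 :=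
  Finset.prod_eq_zero (Finset.mem_range.2 h) (by simp)

theorem card_noLine [Finite k] [FiniteDimensional l V] (hl : Module.finrank k l = 2) (j : ℕ) :
    (Nat.card {U : Submodule k V // NoLine l U ∧ Module.finrank k U = j} : ℚ) =
      spanningCount (Nat.card k) (Module.finrank l V) j := by
  have : FiniteDimensional k l := Module.finite_of_finrank_pos (by omega)
  have : Finite l := Module.finite_of_finite k
  have : Finite V := Module.finite_of_finite l
  have := Fintype.ofFinite l
  have hq : 1 < Nat.card k := Finite.one_lt_card
  have hql : Fintype.card l = Nat.card k ^ 2 := by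
    rw [← Nat.card_eq_fintype_card, Module.natCard_eq_pow_finrank (K := k), hl]
  have hne : ∀ h ∈ Finset.range j, ((Nat.card k : ℚ) ^ j - (Nat.card k : ℚ) ^ h) ≠ 0 := by
    intro h hh
    rw [sub_ne_zero]
    exact_mod_cast (Nat.pow_lt_pow_right hq (Finset.mem_range.1 hh)).ne'
  have hcast : ((∏ i : Fin j, (Nat.card k ^ j - Nat.card k ^ i.val) : ℕ) : ℚ) =
      ∏ h ∈ Finset.range j, ((Nat.card k : ℚ) ^ j - (Nat.card k : ℚ) ^ h) := by
    rw [Fin.prod_univ_eq_prod_range (fun h => Nat.card k ^ j - Nat.card k ^ h) j, Nat.cast_prod]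
    refine Finset.prod_congr rfl fun h hh => ?_
    rw [Nat.cast_sub (Nat.pow_le_pow_right hq.le (Finset.mem_range.1 hh).le)]
    simp
  have hmul := congrArg (Nat.cast : ℕ → ℚ) (card_noLine_mul (V := V) hl j)
  rw [Nat.cast_mul, hcast] at hmul
  rw [spanningCount, Finset.prod_div_distrib, eq_div_iff (Finset.prod_ne_zero_iff.2 hne), hmul]
  rcases le_or_gt j (Module.finrank l V) with h | h
  · rw [card_linearIndependent h, hql,
      Fin.prod_univ_eq_prod_range
        (fun h => (Nat.card k ^ 2) ^ Module.finrank l V - (Nat.card k ^ 2) ^ h) j, Nat.cast_prod]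
    refine Finset.prod_congr rfl fun i hi => ?_
    rw [Nat.cast_sub (Nat.pow_le_pow_right (by positivity) ((Finset.mem_range.1 hi).le.trans h))]
    push_cast
    rw [← pow_mul, ← pow_mul]
  -- For `j` above the dimension both sides vanish: there is no independent tuple, and the factor
  -- with `h` equal to the dimension is zero.
  · have : IsEmpty {s : Fin j → V // LinearIndependent l s} := ⟨fun s => by
      have := s.2.fintype_card_le_finrank
      rw [Fintype.card_fin] at this
      omega⟩
    rw [Nat.card_of_isEmpty, Finset.prod_eq_zero (Finset.mem_range.2 h) (by simp), Nat.cast_zero]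

/-- Orthogonal complement for the trace form exchanges spanning subspaces of codimension `j` with
line-free subspaces of dimension `j`, and codimension `j` means index `q ^ j`. -/
theorem hasZeta_spanning [Finite k] [FiniteDimensional l V] (hl : Module.finrank k l = 2)
    {q d : ℕ} (hq : Nat.card k = q) (hd : Module.finrank l V = d) :
    HasZeta (fun W : {W : Submodule k V // Submodule.span l (W : Set V) = ⊤} =>
        Nat.card (V ⧸ W.1))
      (∑ j ∈ Finset.range (d + 1), spanningCount q d j • dirichletMonomial q ^ j) := by
  subst hq hd
  have : FiniteDimensional k l := Module.finite_of_finrank_pos (by omega)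
  have : FiniteDimensional k V := Module.Finite.trans l V
  have : Finite V := Module.finite_of_finite k
  have hq : 1 < Nat.card k := Finite.one_lt_card
  obtain ⟨B, hB, hs, ha⟩ := exists_trace_form (k := k) (l := l) (V := V)
  have hcard : ∀ W : Submodule k V,
      Nat.card (V ⧸ W) = Nat.card k ^ Module.finrank k (B.orthogonal W) := fun W => by
    rw [Module.natCard_eq_pow_finrank (K := k), LinearMap.BilinForm.finrank_orthogonal hB,
      Submodule.finrank_quotient]
  have e : ∀ j, {W : {W : Submodule k V // Submodule.span l (W : Set V) = ⊤} //
      Nat.card (V ⧸ W.1) = Nat.card k ^ j} ≃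
      {U : Submodule k V // NoLine l U ∧ Module.finrank k U = j} := fun j =>
    { toFun W := ⟨B.orthogonal W.1.1, (noLine_orthogonal_iff hB hs ha _).2 W.1.2,
        Nat.pow_right_injective hq ((hcard _).symm.trans W.2)⟩
      invFun U := ⟨⟨B.orthogonal U.1, (noLine_orthogonal_iff hB hs ha _).1 (by
          rw [LinearMap.BilinForm.orthogonal_orthogonal hB hs.isRefl]; exact U.2.1)⟩, by
          rw [hcard, LinearMap.BilinForm.orthogonal_orthogonal hB hs.isRefl, U.2.2]⟩
      left_inv W := Subtype.ext (Subtype.ext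
        (LinearMap.BilinForm.orthogonal_orthogonal hB hs.isRefl _))
      right_inv U := Subtype.ext (LinearMap.BilinForm.orthogonal_orthogonal hB hs.isRefl _) }
  have hsum : ∀ (N : ℕ) (s : Finset ℕ) (F : ℕ → ArithmeticFunction ℚ),
      (∑ j ∈ s, F j) N = ∑ j ∈ s, F j N := fun N s F => by
    classical
    induction s using Finset.induction_on with
    | empty => simp
    | insert a s has ih => rw [Finset.sum_insert has, Finset.sum_insert has, ← ih]; rfl
  refine ⟨fun N _ => inferInstance, fun N hN => ?_⟩
  rw [hsum]
  simp only [ArithmeticFunction.smul_map, dirichletMonomial_pow (by omega : Nat.card k ≠ 0),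
    dirichletMonomial_apply (pow_ne_zero _ (by omega : Nat.card k ≠ 0)), smul_eq_mul, mul_ite,
    mul_one, mul_zero]
  by_cases h : ∃ j, N = Nat.card k ^ j
  · obtain ⟨j, rfl⟩ := h
    rw [Nat.card_congr (e j), card_noLine hl]
    simp only [(Nat.pow_right_injective hq).eq_iff]
    rw [Finset.sum_ite_eq]
    split_ifs with hj
    · rfl
    · exact spanningCount_eq_zero (by simpa using hj)
  · rw [Finset.sum_eq_zero fun j _ => if_neg fun hj => h ⟨j, hj⟩]
    have : IsEmpty {W : {W : Submodule k V // Submodule.span l (W : Set V) = ⊤} //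
      Nat.card (V ⧸ W.1) = N} := ⟨fun W => h ⟨_, W.2.symm.trans (hcard _)⟩⟩
    rw [Nat.card_of_isEmpty, Nat.cast_zero]

end Spanning

/-! ### Lattices over the order and over its normalization -/

section Order

variable {k l : Type*} [Field k] [Field l] [Algebra k l]

theorem mem_inertOrder_one {f : l⟦X⟧} :
    f ∈ inertOrder k l 1 ↔ ∃ a : k, algebraMap k l a = constantCoeff f := by
  constructor
  · rintro ⟨a, b, rfl⟩
    exact ⟨constantCoeff a, by
      rw [pow_one, map_add, map_mul, constantCoeff_X, zero_mul, add_zero]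
      simpa only [coeff_zero_eq_constantCoeff_apply] using (coeff_map (algebraMap k l) 0 a).symm⟩
  · rintro ⟨a, ha⟩
    obtain ⟨b, hb⟩ := X_dvd_iff.2 (show constantCoeff (f - C (algebraMap k l a)) = 0 by simp [ha])
    exact ⟨C a, b, by rw [pow_one, ← hb, map_C]; ring⟩

theorem X_mul_mem_inertOrder_one (f : l⟦X⟧) : X * f ∈ inertOrder k l 1 :=
  mem_inertOrder_one.2 ⟨0, by simp⟩

variable (k l) in
/-- Multiplication by `T`, as a map from `l[[T]]` to the order `k[[T]] + T l[[T]]`. -/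
noncomputable def mulXToOrder : l⟦X⟧ →ₗ[inertOrder k l 1] inertOrder k l 1 where
  toFun f := ⟨X * f, X_mul_mem_inertOrder_one f⟩
  map_add' f g := Subtype.ext (mul_add _ _ _)
  map_smul' r f := Subtype.ext (by
    change X * ((r : l⟦X⟧) * f) = (r : l⟦X⟧) * (X * f)
    ring)

theorem mulXToOrder_injective : Function.Injective (mulXToOrder k l) := fun _ _ h =>
  mul_left_cancel₀ X_ne_zero (congrArg Subtype.val h)

theorem mem_range_mulXToOrder {r : inertOrder k l 1} :
    r ∈ LinearMap.range (mulXToOrder k l) ↔ constantCoeff (r : l⟦X⟧) = 0 := by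
  rw [← X_dvd_iff]
  constructor
  · rintro ⟨f, rfl⟩
    exact ⟨f, rfl⟩
  · rintro ⟨f, hf⟩
    exact ⟨f, Subtype.ext hf.symm⟩

theorem mem_range_mulXToOrder_iff_not_isUnit (r : inertOrder k l 1) :
    r ∈ LinearMap.range (mulXToOrder k l) ↔ ¬ IsUnit r := by
  rw [mem_range_mulXToOrder, iff_not_comm]
  constructor
  · intro h
    exact ((h.map (inertOrder k l 1).subtype).map (constantCoeff (R := l))).ne_zero
  · intro h
    obtain ⟨a, ha⟩ := mem_inertOrder_one.1 r.2
    have hinv : (r : l⟦X⟧) * (r : l⟦X⟧)⁻¹ = 1 := PowerSeries.mul_inv_cancel _ h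
    refine IsUnit.of_mul_eq_one ⟨(r : l⟦X⟧)⁻¹, mem_inertOrder_one.2 ⟨a⁻¹, ?_⟩⟩ (Subtype.ext hinv)
    rw [constantCoeff_inv, map_inv₀, ha]

theorem card_quotient_range_mulXToOrder :
    Nat.card (inertOrder k l 1 ⧸ LinearMap.range (mulXToOrder k l)) = Nat.card k := by
  let φ : inertOrder k l 1 →+ l :=
    ((constantCoeff (R := l)).comp (inertOrder k l 1).subtype).toAddMonoidHom
  have h1 : (LinearMap.range (mulXToOrder k l)).toAddSubgroup = φ.ker := by
    ext r
    exact mem_range_mulXToOrder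
  have h2 : Set.range φ = Set.range (algebraMap k l) := by
    ext a
    constructor
    · rintro ⟨r, rfl⟩
      exact mem_inertOrder_one.1 r.2
    · rintro ⟨a, rfl⟩
      exact ⟨⟨C (algebraMap k l a), mem_inertOrder_one.2 ⟨a, by simp⟩⟩, by simp [φ]⟩
  rw [card_quotient_eq_index, h1, AddSubgroup.index_ker]
  change Nat.card (Set.range φ) = _
  rw [h2, Nat.card_range_of_injective (algebraMap k l).injective]

theorem mem_range_lsmul_X_iff_not_isUnit (f : l⟦X⟧) :
    f ∈ LinearMap.range (LinearMap.lsmul l⟦X⟧ l⟦X⟧ X) ↔ ¬ IsUnit f := by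
  rw [isUnit_iff_constantCoeff, isUnit_iff_ne_zero, not_not, ← X_dvd_iff]
  exact ⟨fun ⟨g, hg⟩ => ⟨g, hg.symm⟩, fun ⟨g, hg⟩ => ⟨g, hg.symm⟩⟩

theorem card_quotient_range_lsmul_X (d : ℕ) :
    Nat.card ((Fin d → l⟦X⟧) ⧸ LinearMap.range (LinearMap.lsmul l⟦X⟧ (Fin d → l⟦X⟧) X)) =
      Nat.card l ^ d := by
  let φ : (Fin d → l⟦X⟧) →+ (Fin d → l) :=
    { toFun x i := constantCoeff (x i)
      map_zero' := by ext; simp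
      map_add' x y := by ext; simp }
  have h1 : (LinearMap.range (LinearMap.lsmul l⟦X⟧ (Fin d → l⟦X⟧) X)).toAddSubgroup = φ.ker := by
    ext x
    rw [AddMonoidHom.mem_ker, funext_iff]
    change (∃ y, _) ↔ ∀ i, constantCoeff (x i) = 0
    simp only [← X_dvd_iff]
    constructor
    · rintro ⟨y, rfl⟩ i
      exact ⟨y i, rfl⟩
    · intro h
      choose y hy using h
      exact ⟨y, funext fun i => (hy i).symm⟩
  have h2 : Set.range φ = Set.univ :=
    Set.range_eq_univ.2 fun a => ⟨fun i => C (a i), by ext; simp [φ]⟩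
  rw [card_quotient_eq_index, h1, AddSubgroup.index_ker]
  change Nat.card (Set.range φ) = _
  rw [h2, Nat.card_congr (Equiv.Set.univ _), Nat.card_fun, Nat.card_fin]

theorem card_quotient_range_lsmul_X_self :
    Nat.card (l⟦X⟧ ⧸ LinearMap.range (LinearMap.lsmul l⟦X⟧ l⟦X⟧ X)) = Nat.card l := by
  rw [card_quotient_eq_index]
  have h1 : (LinearMap.range (LinearMap.lsmul l⟦X⟧ l⟦X⟧ X)).toAddSubgroup =
      (constantCoeff (R := l)).toAddMonoidHom.ker := by
    ext f
    change _ ↔ constantCoeff f = 0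
    rw [← X_dvd_iff]
    exact ⟨fun ⟨g, hg⟩ => ⟨g, hg.symm⟩, fun ⟨g, hg⟩ => ⟨g, hg.symm⟩⟩
  have h2 : Set.range (constantCoeff (R := l)).toAddMonoidHom = Set.univ :=
    Set.range_eq_univ.2 fun a => ⟨C a, by simp⟩
  rw [h1, AddSubgroup.index_ker]
  change Nat.card (Set.range (constantCoeff (R := l)).toAddMonoidHom) = _
  rw [h2, Nat.card_congr (Equiv.Set.univ _)]

end Order

/-! ### Reduction modulo `T` of submodules over the order -/

section Reduction

variable {k l M V : Type*} [Field k] [Field l] [Algebra k l] [AddCommGroup M] [Module l⟦X⟧ M]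
  [AddCommGroup V] [Module l⟦X⟧ V] [Module k V] [Module l V] [IsScalarTower k l V]

theorem X_smul_mem_of_mem_span {L : Submodule (inertOrder k l 1) M} {x : M}
    (hx : x ∈ Submodule.span l⟦X⟧ (L : Set M)) : (X : l⟦X⟧) • x ∈ L := by
  -- The factor `c` lets the induction absorb scalars of `l⟦X⟧`. The base case holds because `X * c`
  -- lies in the order.
  have h : ∀ c : l⟦X⟧, (X * c) • x ∈ L := by
    induction hx using Submodule.span_induction with
    | mem y hy =>
      intro c
      exact L.smul_mem (⟨X * c, X_mul_mem_inertOrder_one c⟩ : inertOrder k l 1) hy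
    | zero => simp
    | add y z _ _ hy hz =>
      intro c
      rw [smul_add]
      exact L.add_mem (hy c) (hz c)
    | smul a y _ hy =>
      intro c
      rw [smul_smul, mul_assoc]
      exact hy _
  simpa using h 1

/-- The `k`-subspace of `V = M / T M` that is the image of a `k[[T]] + T l[[T]]`-submodule. -/
def reduction (p : M →ₗ[l⟦X⟧] V) (hV : ∀ (s : l⟦X⟧) (v : V), s • v = constantCoeff s • v)
    (L : Submodule (inertOrder k l 1) M) : Submodule k V where
  carrier := p '' L
  zero_mem' := ⟨0, L.zero_mem, map_zero p⟩
  add_mem' := by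
    rintro _ _ ⟨x, hx, rfl⟩ ⟨y, hy, rfl⟩
    exact ⟨x + y, L.add_mem hx hy, map_add p x y⟩
  smul_mem' := by
    rintro a _ ⟨x, hx, rfl⟩
    refine ⟨C (algebraMap k l a) • x, L.smul_mem
      (⟨C (algebraMap k l a), mem_inertOrder_one.2 ⟨a, by simp⟩⟩ : inertOrder k l 1) hx, ?_⟩
    rw [map_smul, hV, constantCoeff_C, algebraMap_smul]

/-- The `k[[T]] + T l[[T]]`-submodule of `M` that is the preimage of a `k`-subspace of
`V = M / T M`. -/
def unreduction (p : M →ₗ[l⟦X⟧] V) (hV : ∀ (s : l⟦X⟧) (v : V), s • v = constantCoeff s • v)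
    (W : Submodule k V) : Submodule (inertOrder k l 1) M where
  carrier := p ⁻¹' W
  zero_mem' := by simp
  add_mem' := by
    intro x y hx hy
    simp only [Set.mem_preimage, map_add, SetLike.mem_coe] at *
    exact W.add_mem hx hy
  smul_mem' := by
    rintro ⟨r, hr⟩ x hx
    obtain ⟨a, ha⟩ := mem_inertOrder_one.1 hr
    change p (r • x) ∈ W
    rw [map_smul, hV, ← ha, algebraMap_smul]
    exact W.smul_mem a hx

variable {p : M →ₗ[l⟦X⟧] V} (hV : ∀ (s : l⟦X⟧) (v : V), s • v = constantCoeff s • v)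

theorem reduction_unreduction (hp : Function.Surjective p) (W : Submodule k V) :
    reduction p hV (unreduction p hV W) = W :=
  SetLike.coe_injective (Set.image_preimage_eq _ hp)

theorem unreduction_reduction (hker : ∀ x, p x = 0 → ∃ y, x = (X : l⟦X⟧) • y)
    {L : Submodule (inertOrder k l 1) M} (hL : Submodule.span l⟦X⟧ (L : Set M) = ⊤) :
    unreduction p hV (reduction p hV L) = L := by
  ext x
  constructor
  · rintro ⟨y, hy, hxy⟩
    obtain ⟨z, hz⟩ := hker (x - y) (by rw [map_sub, hxy, sub_self])
    rw [← sub_add_cancel x y, hz]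
    exact L.add_mem (X_smul_mem_of_mem_span (hL ▸ Submodule.mem_top)) hy
  · exact fun hx => ⟨x, hx, rfl⟩

theorem span_reduction_eq_top (hp : Function.Surjective p)
    {L : Submodule (inertOrder k l 1) M} (hL : Submodule.span l⟦X⟧ (L : Set M) = ⊤) :
    Submodule.span l (reduction p hV L : Set V) = ⊤ := by
  rw [eq_top_iff]
  rintro v -
  obtain ⟨x, rfl⟩ := hp v
  have hx : x ∈ Submodule.span l⟦X⟧ (L : Set M) := hL ▸ Submodule.mem_top
  induction hx using Submodule.span_induction with
  | mem y hy => exact Submodule.subset_span ⟨y, hy, rfl⟩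
  | zero => simp
  | add y z _ _ hy hz => rw [map_add]; exact Submodule.add_mem _ hy hz
  | smul a y _ hy => rw [map_smul, hV]; exact Submodule.smul_mem _ _ hy

theorem span_eq_top_of_span_reduction_eq_top [Module.Finite l⟦X⟧ M]
    (hker : ∀ x, p x = 0 → ∃ y, x = (X : l⟦X⟧) • y)
    {L : Submodule (inertOrder k l 1) M}
    (hL : Submodule.span l (reduction p hV L : Set V) = ⊤) :
    Submodule.span l⟦X⟧ (L : Set M) = ⊤ := by
  have h1 : ∀ v ∈ Submodule.span l (reduction p hV L : Set V),
      ∃ y ∈ Submodule.span l⟦X⟧ (L : Set M), p y = v := by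
    intro v hv
    induction hv using Submodule.span_induction with
    | mem v hv =>
      obtain ⟨y, hy, rfl⟩ := hv
      exact ⟨y, Submodule.subset_span hy, rfl⟩
    | zero => exact ⟨0, Submodule.zero_mem _, map_zero p⟩
    | add v w _ _ hv hw =>
      obtain ⟨y, hy, rfl⟩ := hv
      obtain ⟨z, hz, rfl⟩ := hw
      exact ⟨y + z, Submodule.add_mem _ hy hz, map_add p y z⟩
    | smul a v _ hv =>
      obtain ⟨y, hy, rfl⟩ := hv
      exact ⟨C a • y, Submodule.smul_mem _ _ hy, by rw [map_smul, hV, constantCoeff_C]⟩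
  rw [eq_top_iff]
  -- Nakayama's lemma: generation modulo `T` implies generation.
  refine Submodule.le_of_le_smul_of_le_jacobson_bot (I := IsLocalRing.maximalIdeal l⟦X⟧)
    Module.Finite.fg_top (IsLocalRing.maximalIdeal_le_jacobson ⊥) fun x _ => ?_
  obtain ⟨y, hy, hxy⟩ := h1 (p x) (hL ▸ Submodule.mem_top)
  obtain ⟨z, hz⟩ := hker (x - y) (by rw [map_sub, hxy, sub_self])
  rw [← add_sub_cancel y x, hz]
  refine Submodule.add_mem_sup hy (Submodule.smul_mem_smul ?_ Submodule.mem_top)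
  rw [IsLocalRing.mem_maximalIdeal, mem_nonunits_iff, isUnit_iff_constantCoeff]
  simp

/-- The `k[[T]] + T l[[T]]`-submodules of `M` that span it over `l[[T]]` correspond to the
`k`-subspaces of `M / T M` that span it over `l`. -/
def reductionEquiv [Module.Finite l⟦X⟧ M] (hp : Function.Surjective p)
    (hker : ∀ x, p x = 0 → ∃ y, x = (X : l⟦X⟧) • y) :
    {L : Submodule (inertOrder k l 1) M // Submodule.span l⟦X⟧ (L : Set M) = ⊤} ≃
      {W : Submodule k V // Submodule.span l (W : Set V) = ⊤} where
  toFun L := ⟨reduction p hV L.1, span_reduction_eq_top hV hp L.2⟩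
  invFun W := ⟨unreduction p hV W.1, span_eq_top_of_span_reduction_eq_top hV hker
    (by rw [reduction_unreduction hV hp]; exact W.2)⟩
  left_inv L := Subtype.ext (unreduction_reduction hV hker L.2)
  right_inv W := Subtype.ext (reduction_unreduction hV hp W.1)

theorem card_quotient_unreduction (hp : Function.Surjective p) (W : Submodule k V) :
    Nat.card (M ⧸ unreduction p hV W) = Nat.card (V ⧸ W) := by
  have hs : Function.Surjective p.toAddMonoidHom := hp
  have h : (unreduction p hV W).toAddSubgroup = W.toAddSubgroup.comap p.toAddMonoidHom := rfl
  rw [card_quotient_eq_index, card_quotient_eq_index, h,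
    AddSubgroup.index_comap_of_surjective _ hs]

variable (k) in
theorem hasZeta_spanning_of_reduction [Finite k] [Module.Finite l⟦X⟧ M] [FiniteDimensional l V]
    (hl : Module.finrank k l = 2) {q d : ℕ} (hq : Nat.card k = q) (hd : Module.finrank l V = d)
    (hV : ∀ (s : l⟦X⟧) (v : V), s • v = constantCoeff s • v)
    (hp : Function.Surjective p) (hker : ∀ x, p x = 0 → ∃ y, x = (X : l⟦X⟧) • y) :
    HasZeta (fun L : {L : Submodule (inertOrder k l 1) M //
        Submodule.span l⟦X⟧ (L : Set M) = ⊤} => Nat.card (M ⧸ L.1))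
      (∑ j ∈ Finset.range (d + 1), spanningCount q d j • dirichletMonomial q ^ j) := by
  refine (hasZeta_spanning (V := V) hl hq hd).congr_equiv (reductionEquiv hV hp hker) fun L => ?_
  rw [← card_quotient_unreduction hV hp]
  exact congrArg (fun L' : Submodule (inertOrder k l 1) M => Nat.card (M ⧸ L'))
    (unreduction_reduction hV hker L.2)

end Reduction

/-! ### Fibering lattices over their `l⟦X⟧`-span -/

section Lattices

variable {k l : Type*} [Field k] [Finite k] [Field l] [Algebra k l]

/-- With `N = l⟦X⟧ ^ d`, compute `(N : T M)` through `T N` and through `M`: `(N : T N) (N : M) = (N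
: M) (M : T M)`. Cancelling the finite `(N : M)` avoids showing that `M` is free. -/
theorem card_quotient_range_lsmul_X_submodule [Finite l] {d : ℕ}
    (M : Submodule l⟦X⟧ (Fin d → l⟦X⟧)) (hM : Nat.card ((Fin d → l⟦X⟧) ⧸ M) ≠ 0) :
    Nat.card (M ⧸ LinearMap.range (LinearMap.lsmul l⟦X⟧ M X)) = Nat.card l ^ d := by
  have hinj : Function.Injective (LinearMap.lsmul l⟦X⟧ (Fin d → l⟦X⟧) X) := by
    intro x y h
    funext i
    exact mul_left_cancel₀ X_ne_zero (congrFun h i)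
  have h1 := card_quotient_of_le_range (LinearMap.lsmul l⟦X⟧ (Fin d → l⟦X⟧) X)
    (L := M.map (LinearMap.lsmul l⟦X⟧ (Fin d → l⟦X⟧) X)) LinearMap.map_le_range
  rw [Submodule.comap_map_eq_of_injective hinj, card_quotient_range_lsmul_X] at h1
  have hle : M.map (LinearMap.lsmul l⟦X⟧ (Fin d → l⟦X⟧) X) ≤ LinearMap.range M.subtype := by
    rw [Submodule.range_subtype, Submodule.map_le_iff_le_comap]
    exact fun x hx => M.smul_mem _ hx
  have h2 := card_quotient_of_le_range M.subtype hle
  rw [h1, Submodule.range_subtype, mul_comm] at h2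
  rw [Nat.eq_of_mul_eq_mul_left (Nat.pos_of_ne_zero hM) h2]
  congr 2
  ext x
  constructor
  · rintro ⟨y, rfl⟩
    exact ⟨y, y.2, rfl⟩
  · rintro ⟨y, hy, hxy⟩
    exact ⟨⟨y, hy⟩, Subtype.ext hxy⟩

variable (k) in
/-- The `k[[T]] + T l[[T]]`-submodules of a module that span `M` over `l[[T]]`. -/
noncomputable def spanEqEquiv {N : Type*} [AddCommGroup N] [Module l⟦X⟧ N]
    (M : Submodule l⟦X⟧ N) :
    {L : Submodule (inertOrder k l 1) N // Submodule.span l⟦X⟧ (L : Set N) = M} ≃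
      {L : Submodule (inertOrder k l 1) M // Submodule.span l⟦X⟧ (L : Set M) = ⊤} where
  toFun L := ⟨L.1.comap (M.subtype.restrictScalars (inertOrder k l 1)), by
    have hL : (L.1 : Set N) ⊆ M := fun x hx => L.2 ▸ Submodule.subset_span hx
    refine Submodule.map_injective_of_injective M.injective_subtype ?_
    rw [Submodule.map_span, Submodule.map_top, Submodule.range_subtype]
    conv_rhs => rw [← L.2]
    congr 1
    ext x
    exact ⟨fun ⟨y, hy, hxy⟩ => hxy ▸ hy, fun hx => ⟨⟨x, hL hx⟩, hx, rfl⟩⟩⟩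
  invFun L := ⟨L.1.map (M.subtype.restrictScalars (inertOrder k l 1)), by
    rw [Submodule.map_coe, LinearMap.coe_restrictScalars, ← Submodule.map_span, L.2,
      Submodule.map_top, Submodule.range_subtype]⟩
  left_inv L := Subtype.ext (by
    have hL : (L.1 : Set N) ⊆ M := fun x hx => L.2 ▸ Submodule.subset_span hx
    ext x
    exact ⟨fun ⟨y, hy, hxy⟩ => hxy ▸ hy, fun hx => ⟨⟨x, hL hx⟩, hx, rfl⟩⟩)
  right_inv L := Subtype.ext (Submodule.comap_map_eq_of_injective
    (f := M.subtype.restrictScalars (inertOrder k l 1)) M.injective_subtype L.1)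

/-- The index of `L` factors through its span `M`, and the series of the relative indices `(M : L)`
depends only on `dim_l M / T M = d`, so the series multiply. -/
theorem hasZeta_order_lattices (hl : Module.finrank k l = 2) {q : ℕ} (hq : Nat.card k = q) (d : ℕ)
    {f : ArithmeticFunction ℚ}
    (hf : HasZeta (fun M : Submodule l⟦X⟧ (Fin d → l⟦X⟧) => Nat.card ((Fin d → l⟦X⟧) ⧸ M)) f) :
    HasZeta (fun L : Submodule (inertOrder k l 1) (Fin d → l⟦X⟧) =>
        Nat.card ((Fin d → l⟦X⟧) ⧸ L))
      (f * ∑ j ∈ Finset.range (d + 1), spanningCount q d j • dirichletMonomial q ^ j) := by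
  have : FiniteDimensional k l := Module.finite_of_finrank_pos (by omega)
  have : Finite l := Module.finite_of_finite k
  refine hf.mul_of_fibers (fun L => Submodule.span l⟦X⟧ (L : Set (Fin d → l⟦X⟧)))
    (fun L => L.toAddSubgroup.relIndex
      (Submodule.span l⟦X⟧ (L : Set (Fin d → l⟦X⟧))).toAddSubgroup) (fun L => ?_) fun M hM => ?_
  · rw [card_quotient_eq_index, card_quotient_eq_index, mul_comm]
    refine (AddSubgroup.relIndex_mul_index ?_).symm
    exact fun x hx => Submodule.subset_span hx
  · let N := LinearMap.range (LinearMap.lsmul l⟦X⟧ M X)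
    have hcard : Nat.card (M ⧸ N) = Nat.card l ^ d := card_quotient_range_lsmul_X_submodule M hM
    have hfin : Finite (M ⧸ N) := Nat.finite_of_card_ne_zero (by
      rw [hcard]
      exact pow_ne_zero _ Nat.card_pos.ne')
    have : FiniteDimensional l (M ⧸ N) := Module.Finite.of_finite
    have hd : Module.finrank l (M ⧸ N) = d := by
      rw [Module.natCard_eq_pow_finrank (K := l)] at hcard
      exact Nat.pow_right_injective (Finite.one_lt_card (α := l)) hcard
    have hker : ∀ x, N.mkQ x = 0 → ∃ y, x = (X : l⟦X⟧) • y := fun x hx => by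
      rw [Submodule.mkQ_apply, Submodule.Quotient.mk_eq_zero] at hx
      obtain ⟨y, hy⟩ := hx
      exact ⟨y, hy.symm⟩
    have hV : ∀ (s : l⟦X⟧) (v : M ⧸ N), s • v = constantCoeff s • v := by
      intro s v
      obtain ⟨x, rfl⟩ := N.mkQ_surjective v
      rw [← algebraMap_smul l⟦X⟧ (constantCoeff s) (N.mkQ x)]
      change s • N.mkQ x = C (constantCoeff s) • N.mkQ x
      obtain ⟨t, ht⟩ := X_dvd_iff.2
        (show constantCoeff (s - C (constantCoeff s)) = 0 by simp)
      rw [← sub_eq_zero, ← sub_smul, ht, ← map_smul, Submodule.mkQ_apply,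
        Submodule.Quotient.mk_eq_zero, mul_smul]
      exact ⟨_, rfl⟩
    refine (hasZeta_spanning_of_reduction k hl hq hd hV N.mkQ_surjective hker).congr_equiv
      (spanEqEquiv k M) fun L => ?_
    rw [L.2]
    rfl

end Lattices

/-! ### `q`-series identities -/

theorem qPochhammer_succ {A : Type*} [CommRing A] (a q : A) (n : ℕ) :
    qPochhammer a q (n + 1) = qPochhammer a q n * (1 - a * q ^ n) :=
  Finset.prod_range_succ _ _

theorem qPochhammer_self_ne_zero {x : ℚ} (h0 : 0 ≤ x) (h1 : x < 1) (n : ℕ) :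
    qPochhammer x x n ≠ 0 := by
  refine Finset.prod_ne_zero_iff.2 fun k _ => ?_
  rw [← pow_succ', sub_ne_zero]
  exact (pow_lt_one₀ h0 h1 k.succ_ne_zero).ne'

theorem qBinomial_zero_right {x : ℚ} (h0 : 0 ≤ x) (h1 : x < 1) (n : ℕ) : qBinomial n 0 x = 1 := by
  have : qPochhammer x x 0 = 1 := Finset.prod_range_zero _
  rw [qBinomial, if_pos n.zero_le, Nat.sub_zero, this, one_mul]
  exact div_self (qPochhammer_self_ne_zero h0 h1 n)

theorem qBinomial_self {x : ℚ} (h0 : 0 ≤ x) (h1 : x < 1) (n : ℕ) : qBinomial n n x = 1 := by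
  rw [qBinomial, if_pos le_rfl, Nat.sub_self]
  have : qPochhammer x x 0 = 1 := Finset.prod_range_zero _
  rw [this, mul_one, div_self (qPochhammer_self_ne_zero h0 h1 n)]

theorem qBinomial_eq_zero {n i : ℕ} (h : n < i) (x : ℚ) : qBinomial n i x = 0 :=
  if_neg (by omega)

theorem qBinomial_succ_succ {x : ℚ} (h0 : 0 ≤ x) (h1 : x < 1) {n i : ℕ} (hi : i ≤ n) :
    qBinomial (n + 1) (i + 1) x = qBinomial n (i + 1) x + x ^ (n - i) * qBinomial n i x := by
  rcases hi.eq_or_lt with rfl | hlt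
  · rw [qBinomial_self h0 h1, qBinomial_self h0 h1, qBinomial_eq_zero (by omega)]
    simp
  · obtain ⟨m, rfl⟩ : ∃ m, n = i + 1 + m := ⟨n - (i + 1), by omega⟩
    rw [qBinomial, qBinomial, qBinomial, if_pos (by omega), if_pos (by omega), if_pos (by omega)]
    rw [show i + 1 + m + 1 - (i + 1) = m + 1 by omega, show i + 1 + m - (i + 1) = m by omega,
      show i + 1 + m - i = m + 1 by omega]
    have hn := qPochhammer_succ x x (i + 1 + m)
    have hi := qPochhammer_succ x x i
    have hm := qPochhammer_succ x x m
    have n1 := qPochhammer_self_ne_zero h0 h1 (i + 1)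
    have n2 := qPochhammer_self_ne_zero h0 h1 (m + 1)
    have n3 := qPochhammer_self_ne_zero h0 h1 i
    have n4 := qPochhammer_self_ne_zero h0 h1 m
    rw [hi] at n1
    rw [hm] at n2
    rw [hn, hi, hm]
    have n5 := right_ne_zero_of_mul n1
    have n6 := right_ne_zero_of_mul n2
    field_simp
    ring

theorem prod_pow_sub_pow {q : ℚ} (hq : q ≠ 0) (j : ℕ) :
    ∏ h ∈ Finset.range j, (q ^ j - q ^ h) = q ^ (j * j) * qPochhammer q⁻¹ q⁻¹ j := by
  have hc : q ^ (j * j) = ∏ _h ∈ Finset.range j, q ^ j := by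
    rw [Finset.prod_const, Finset.card_range, pow_mul]
  rw [hc, qPochhammer, ← Finset.prod_range_reflect (fun h => 1 - q⁻¹ * q⁻¹ ^ h), ← Finset.prod_mul_distrib]
  refine Finset.prod_congr rfl fun h hh => ?_
  obtain ⟨m, rfl⟩ : ∃ m, j = h + 1 + m := ⟨j - (h + 1), by have := Finset.mem_range.1 hh; omega⟩
  rw [show h + 1 + m - 1 - h = m by omega, ← pow_succ', mul_sub, mul_one, inv_pow,
    show h + 1 + m = h + (m + 1) by omega, pow_add, mul_assoc, mul_inv_cancel₀ (pow_ne_zero _ hq),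
    mul_one]

/-- Pulling `-q^{2h}` out of each factor leaves `q^{j(j-1)}`; the extra `q ^ j` on the left
completes it to `q^{j^2}` and avoids subtraction in the exponent. -/
theorem prod_pow_sub_pow_two_mul {q : ℚ} (hq : q ≠ 0) (d j : ℕ) :
    (∏ h ∈ Finset.range j, (q ^ (2 * d) - q ^ (2 * h))) * q ^ j =
      (-1) ^ j * q ^ (j * j) * qPochhammer (q ^ (2 * d)) (q ^ 2)⁻¹ j := by
  induction j with
  | zero => simp [qPochhammer]
  | succ j ih =>
    rw [Finset.prod_range_succ, qPochhammer_succ, pow_succ q j,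
      show ∀ a b c e : ℚ, a * b * (c * e) = a * c * (b * e) by intros; ring, ih]
    have : (q ^ 2)⁻¹ ^ j = (q ^ (2 * j))⁻¹ := by rw [inv_pow, pow_mul]
    rw [this]
    field_simp
    ring

theorem spanningCount_eq {q : ℕ} (hq : q ≠ 0) (d j : ℕ) :
    spanningCount q d j = (-1) ^ j * (q : ℚ)⁻¹ ^ j *
      (qPochhammer ((q : ℚ) ^ (2 * d)) ((q : ℚ) ^ 2)⁻¹ j / qPochhammer (q : ℚ)⁻¹ (q : ℚ)⁻¹ j) := by
  have hq0 : (q : ℚ) ≠ 0 := by exact_mod_cast hq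
  rw [spanningCount, Finset.prod_div_distrib, prod_pow_sub_pow hq0,
    eq_div_of_mul_eq (pow_ne_zero j hq0) (prod_pow_sub_pow_two_mul hq0 d j), inv_pow]
  have := pow_ne_zero (j * j) hq0
  have := pow_ne_zero j hq0
  field_simp

/-! ### The zeta function of `l[[T]] ^ d` -/

theorem map_ringInverse_of_isUnit {A B : Type*} [CommRing A] [CommRing B] (f : A →+* B) {a : A}
    (ha : IsUnit a) : f (Ring.inverse a) = Ring.inverse (f a) := by
  have h := ha.map f
  refine h.mul_left_cancel ?_
  rw [← map_mul, Ring.mul_inverse_cancel _ ha, map_one, Ring.mul_inverse_cancel _ h]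

/-- Every factor is 1 minus a series supported on multiples of `q ^ 2`, so its coefficient at 1 is
1. -/
theorem isUnit_qPochhammer {q : ℕ} (hq : 1 < q) (c : ℚ) (i : ℕ) :
    IsUnit (qPochhammer (dirichletMonomial q ^ 2 * algebraMap ℚ (ArithmeticFunction ℚ) c)
      (algebraMap ℚ (ArithmeticFunction ℚ) c) i) := by
  refine IsUnit.prod_iff.2 fun k _ => isUnit_one_sub ?_
  rw [mul_assoc, dirichletMonomial_pow (by omega), dirichletMonomial_mul_apply (by positivity),
    if_neg]
  rw [Nat.dvd_one]
  exact (Nat.one_lt_pow two_ne_zero hq).ne'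

/-- Over `l⟦X⟧` the ideal of non-units is again free of rank one, so adding a factor multiplies the
shifted series by `1 / (1 - q^{-2s})`. After the twist by `-(d+1)` this is the next Pochhammer
factor. -/
theorem exists_hasZeta_powerSeries (l : Type*) [Field l] {q : ℕ} (hq : 1 < q)
    (hl : Nat.card l = q ^ 2) (d : ℕ) :
    ∃ Z : ArithmeticFunction ℚ,
      HasZeta (fun M : Submodule l⟦X⟧ (Fin d → l⟦X⟧) => Nat.card ((Fin d → l⟦X⟧) ⧸ M)) Z ∧
      twist (-d) Z = Ring.inverse (qPochhammer
        (dirichletMonomial q ^ 2 * algebraMap ℚ (ArithmeticFunction ℚ) ((q : ℚ) ^ 2)⁻¹)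
        (algebraMap ℚ (ArithmeticFunction ℚ) ((q : ℚ) ^ 2)⁻¹) d) := by
  induction d with
  | zero =>
    exact ⟨1, hasZeta_of_subsingleton, by simp [qPochhammer, twist_zero]⟩
  | succ d ih =>
    obtain ⟨Z, hZ, hZ'⟩ := ih
    have hinj : Function.Injective (LinearMap.lsmul l⟦X⟧ l⟦X⟧ X) := fun _ _ h =>
      mul_left_cancel₀ X_ne_zero h
    have h := HasZeta.prod_self (LinearMap.lsmul l⟦X⟧ l⟦X⟧ X) hinj
      mem_range_lsmul_X_iff_not_isUnit (card_quotient_range_lsmul_X_self.trans hl)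
      (Nat.one_lt_pow two_ne_zero hq) hZ
    refine ⟨_, h.of_linearEquiv (Fin.consLinearEquiv l⟦X⟧ fun _ => l⟦X⟧).symm, ?_⟩
    have hq2 : q ^ 2 ≠ 0 := by positivity
    have hu : IsUnit (1 - dirichletMonomial (q ^ 2)) := isUnit_one_sub (by
      rw [dirichletMonomial_apply hq2, if_neg (Nat.one_lt_pow two_ne_zero hq).ne])
    rw [map_mul, twist_twist, qPochhammer_succ, Ring.mul_inverse_rev, ← hZ']
    congr 1
    · refine (map_ringInverse_of_isUnit (twist _ : _ →ₐ[ℚ] _).toRingHom hu).trans ?_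
      congr 1
      change twist _ _ = _
      rw [map_sub, map_one, twist_dirichletMonomial, dirichletMonomial_pow (by omega), mul_assoc,
        ← map_pow, ← map_mul, ← Algebra.commutes, ← Algebra.smul_def]
      congr 2
      rw [← pow_succ', inv_pow, ← zpow_natCast, ← zpow_neg]
      push_cast
      rfl
    · congr 2
      push_cast
      ring

/-! ### The recursion on the rank -/

section Recursion

variable {k l : Type*} [Field k] [Finite k] [Field l] [Algebra k l]

/-- The induction on `n` keeps `d` arbitrary, because a factor of the order may turn into a factor
`l⟦X⟧`. The exponent of `q^{-1}` evolves by `i^2 + i + (n + 1) = (i + 1)^2 + (n - i)`, leaving the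
weight `n - i` of the `q`-Pascal rule. -/
theorem exists_hasZeta_prod {q : ℕ} (hq : Nat.card k = q) {Z : ℕ → ArithmeticFunction ℚ}
    (hZ : ∀ d, HasZeta (fun L : Submodule (inertOrder k l 1) (Fin d → l⟦X⟧) =>
      Nat.card ((Fin d → l⟦X⟧) ⧸ L)) (Z d)) (n : ℕ) :
    ∀ d, ∃ F : ArithmeticFunction ℚ,
      HasZeta (fun L : Submodule (inertOrder k l 1)
        ((Fin n → inertOrder k l 1) × (Fin d → l⟦X⟧)) => Nat.card (_ ⧸ L)) F ∧
      twist (-n) F = ∑ i ∈ Finset.range (n + 1), (qBinomial n i (q : ℚ)⁻¹ * (q : ℚ)⁻¹ ^ (i ^ 2)) •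
        (dirichletMonomial q ^ i * twist (-i) (Z (d + i))) := by
  have hq1 : 1 < q := hq ▸ Finite.one_lt_card
  have hq0 : (q : ℚ) ≠ 0 := by positivity
  have h0 : 0 ≤ (q : ℚ)⁻¹ := by positivity
  have h1 : (q : ℚ)⁻¹ < 1 := inv_lt_one_of_one_lt₀ (by exact_mod_cast hq1)
  induction n with
  | zero =>
    intro d
    exact ⟨Z d, (hZ d).of_linearEquiv LinearEquiv.uniqueProd, by
      simp [qBinomial_zero_right h0 h1]⟩
  | succ n ih =>
    intro d
    obtain ⟨F, hF, hF'⟩ := ih d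
    obtain ⟨G, hG, hG'⟩ := ih (d + 1)
    let P := (Fin n → inertOrder k l 1)
    let e₁ : (inertOrder k l 1 × (P × (Fin d → l⟦X⟧))) ≃ₗ[inertOrder k l 1]
        ((Fin (n + 1) → inertOrder k l 1) × (Fin d → l⟦X⟧)) :=
      (LinearEquiv.prodAssoc _ _ _ _).symm.trans
        ((Fin.consLinearEquiv (inertOrder k l 1) fun _ => inertOrder k l 1).prodCongr
          (LinearEquiv.refl _ _))
    let e₂ : (l⟦X⟧ × (P × (Fin d → l⟦X⟧))) ≃ₗ[inertOrder k l 1]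
        (P × (Fin (d + 1) → l⟦X⟧)) :=
      (LinearEquiv.prodAssoc _ _ _ _).symm.trans
        (((LinearEquiv.prodComm _ _ _).prodCongr (LinearEquiv.refl _ _)).trans
          ((LinearEquiv.prodAssoc _ _ _ _).trans ((LinearEquiv.refl _ _).prodCongr
            (Fin.consLinearEquiv (inertOrder k l 1) fun _ => l⟦X⟧))))
    refine ⟨_, (HasZeta.prod (mulXToOrder k l) mulXToOrder_injective
      mem_range_mulXToOrder_iff_not_isUnit (card_quotient_range_mulXToOrder.trans hq) (by omega)
      hF (hG.of_linearEquiv e₂)).of_linearEquiv e₁.symm, ?_⟩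
    have hFt : twist (-(n + 1 : ℕ)) (twist 1 F) = twist (-n) F := by
      rw [twist_twist]
      congr 2
      push_cast
      ring
    have hGt : twist (-(n + 1 : ℕ)) (dirichletMonomial q * G) =
        ∑ i ∈ Finset.range (n + 1),
          ((q : ℚ)⁻¹ ^ (n - i) * qBinomial n i (q : ℚ)⁻¹ * (q : ℚ)⁻¹ ^ ((i + 1) ^ 2)) •
          (dirichletMonomial q ^ (i + 1) * twist (-(i + 1 : ℕ)) (Z (d + (i + 1)))) := by
      have : twist (-(n + 1 : ℕ)) G = twist (-1) (twist (-n) G) := by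
        rw [twist_twist]
        congr 2
        push_cast
        ring
      rw [map_mul, this, hG', map_sum, Finset.mul_sum]
      refine Finset.sum_congr rfl fun i hi => ?_
      have hin : i ≤ n := by simpa [Nat.lt_succ_iff] using hi
      rw [map_smul, map_mul, map_pow, twist_dirichletMonomial, twist_dirichletMonomial, twist_twist,
        smul_pow, show d + 1 + i = d + (i + 1) by omega,
        show -(i : ℤ) + -1 = -(i + 1 : ℕ) by push_cast; ring]
      simp only [smul_mul_assoc, mul_smul_comm, smul_smul, ← mul_assoc, ← pow_succ']
      congr 1
      rw [zpow_neg_one, zpow_neg, zpow_natCast, ← inv_pow]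
      obtain ⟨m, rfl⟩ := Nat.exists_eq_add_of_le hin
      rw [show i + m - i = m by omega]
      ring
    rw [map_add, hFt, hGt, hF']
    symm
    -- Set `i = 0` apart and split the other binomials by `q`-Pascal: one half is the sum from
    -- `hGt`, the other together with `i = 0` is the sum from `hF'`.
    rw [Finset.sum_range_succ', Finset.sum_congr rfl fun i hi => by
      rw [qBinomial_succ_succ h0 h1 (by simpa [Nat.lt_succ_iff] using hi : i ≤ n), add_mul,
        add_smul], Finset.sum_add_distrib, qBinomial_zero_right h0 h1, add_right_comm]
    congr 1
    rw [← qBinomial_zero_right h0 h1 n, ← Finset.sum_range_succ'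
      (fun i => (qBinomial n i (q : ℚ)⁻¹ * (q : ℚ)⁻¹ ^ (i ^ 2)) •
        (dirichletMonomial q ^ i * twist (-i) (Z (d + i)))), Finset.sum_range_succ,
      qBinomial_eq_zero (Nat.lt_succ_self n), zero_mul, zero_smul, add_zero]

end Recursion

theorem HasZeta.quotZeta_eq {R M : Type*} [CommRing R] [AddCommGroup M] [Module R M]
    {f : ArithmeticFunction ℚ} (h : HasZeta (fun L : Submodule R M => Nat.card (M ⧸ L)) f) :
    quotZeta R M = f := by
  ext N
  rcases eq_or_ne N 0 with rfl | hN
  · simp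
  · rw [← h.card N hN]
    exact if_neg hN

end InertCoh

theorem mainTheorem1 (k l : Type*) [Field k] [Finite k] [Field l] [Algebra k l]
    (hl : Module.finrank k l = 2) (q : ℕ) (hq : Nat.card k = q) (n : ℕ)
    (t Q : ArithmeticFunction ℚ) (ht : t = InertCoh.dirichletMonomial q)
    (hQ : Q = algebraMap ℚ (ArithmeticFunction ℚ) ((q : ℚ) ^ 2)⁻¹) :
    -- both sides are well defined
    (∀ N : ℕ, N ≠ 0 →
      (InertCoh.submodulesOfIndex (InertCoh.inertOrder k l 1)
        (Fin n → InertCoh.inertOrder k l 1) N).Finite) ∧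
    (∀ i : ℕ, IsUnit (InertCoh.qPochhammer (t ^ 2 * Q) Q i)) ∧
    -- the formula
    InertCoh.finitizedCohZeta (InertCoh.inertOrder k l 1) n =
      ∑ i ∈ Finset.range (n + 1), ∑ j ∈ Finset.range (i + 1),
        ((-1 : ℚ) ^ j * ((q : ℚ)⁻¹) ^ (i ^ 2 + i * j + j) * InertCoh.qBinomial n i (q : ℚ)⁻¹ *
            (InertCoh.qPochhammer ((q : ℚ) ^ (2 * i)) ((q : ℚ) ^ 2)⁻¹ j /
              InertCoh.qPochhammer (q : ℚ)⁻¹ (q : ℚ)⁻¹ j)) •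
          (t ^ (i + j) * Ring.inverse (InertCoh.qPochhammer (t ^ 2 * Q) Q i)) := by
  subst ht hQ
  have hq1 : 1 < q := hq ▸ Finite.one_lt_card
  have : FiniteDimensional k l := Module.finite_of_finrank_pos (by omega)
  have hcard : Nat.card l = q ^ 2 := by
    rw [Module.natCard_eq_pow_finrank (K := k), hl, hq]
  choose Y hY hY' using InertCoh.exists_hasZeta_powerSeries l hq1 hcard
  -- The case `d = 0`: the second factor of the product is trivial.
  obtain ⟨F, hF, hF'⟩ := InertCoh.exists_hasZeta_prod hq
    (fun d => InertCoh.hasZeta_order_lattices hl hq d (hY d)) n 0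
  have hR := hF.of_linearEquiv (M := Fin n → InertCoh.inertOrder k l 1)
    LinearEquiv.prodUnique.symm
  refine ⟨fun N hN => Set.finite_coe_iff.1 (hR.finite N hN),
    InertCoh.isUnit_qPochhammer hq1 _, ?_⟩
  rw [InertCoh.finitizedCohZeta, InertCoh.shift_eq_twist, hR.quotZeta_eq, hF']
  refine Finset.sum_congr rfl fun i _ => ?_
  rw [zero_add, map_mul, hY', map_sum, Finset.mul_sum, Finset.mul_sum, Finset.smul_sum]
  refine Finset.sum_congr rfl fun j _ => ?_
  -- Twisting `t ^ j` by `-i` gives the `i * j` in the exponent; `spanningCount_eq` gives the `j`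
  -- and the sign.
  rw [map_smul, map_pow, InertCoh.twist_dirichletMonomial, smul_pow,
    InertCoh.spanningCount_eq (by omega), zpow_neg, zpow_natCast, ← inv_pow (q : ℚ) i, ← pow_mul _ i j]
  simp only [mul_smul_comm, smul_smul]
  congr 1
  · ring
  · ring
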